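/- Let $(A_r)_{r\ge 1}$ be nonnegative reals and let $1<p<\infty$. There is a constant $C$, depending only on $p$ and $(A_r)_{r\ge1}$, such that the following holds. Let $(X,\mu)$ be a $\sigma$-finite measure space, write $L^q=L^q(X,\mu;\mathbb{C})$, and let $\Delta_1,\dots,\Delta_L$ ($L$ finite) be bounded self-adjoint operators on $L^2$ with $\sum_{l=1}^L\Delta_l=I$. Call a function simple if it is a complex-valued measurable function taking finitely many values and vanishing outside a set of finite measure. Assume that $\Delta_l f\in L^q$ for every simple $f$, every $1\le l\le L$ and every $1<q<\infty$, and that for every integer $r\ge1$ and every simple $f$: (i) (type IV superorthogonality) for all pairwise distinct indices $l_1,\dots,l_{2r}\in\{1,\dots,L\}$, $$\int_X \Delta_{l_1}f\,\overline{\Delta_{l_2}f}\cdots \Delta_{l_{2r-1}}f\,\overline{\Delta_{l_{2r}}f}\,d\mu=0;$$ (ii) $$\Big\|\Big(\sum_{l=1}^L|\Delta_l f|^{2r}\Big)^{1/(2r)}\Big\|_{L^{2r}}\le A_r\,\|f\|_{L^{2r}}.$$ Then each $\Delta_l$, restricted to $L^2\cap L^p$, extends uniquely to a bounded linear operator on $L^p$,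 still denoted $\Delta_l$, and for all $f\in L^p$ $$C^{-1}\|f\|_{L^p}\le\Big\|\Big(\sum_{l=1}^L|\Delta_l f|^2\Big)^{1/2}\Big\|_{L^p}\le C\|f\|_{L^p}.$$ -/

import Mathlib

open MeasureTheory
open scoped ENNReal NNReal ComplexConjugate

/-- Type IV superorthogonality of order `r` of a finite family `f 0, …, f (L - 1)` of complex
valued functions (understood to lie in `L^{2r}`, so that the integrand is integrable): for every
tuple of pairwise distinct indices `l 0, …, l (2 r - 1)`,
`∫ f_{l 0} * conj f_{l 1} * ⋯ * f_{l (2 r - 2)} * conj f_{l (2 r - 1)} dμ = 0`. -/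
def TypeIVSuperorthogonal {X : Type*} [MeasurableSpace X] (μ : Measure X) (r : ℕ) {L : ℕ}
    (f : Fin L → X → ℂ) : Prop :=
  ∀ l : Fin (2 * r) → Fin L, Function.Injective l →
    ∫ x, ∏ j : Fin r,
      (f (l ⟨2 * (j : ℕ), by omega⟩) x * conj (f (l ⟨2 * (j : ℕ) + 1, by omega⟩) x)) ∂μ = 0

/-- The pointwise `ℓ^q` norm `x ↦ (∑ l, |f_l(x)|^q)^{1/q}` of a finite family of functions. -/
noncomputable def ellNorm {X : Type*} (q : ℕ) {L : ℕ} (f : Fin L → X → ℂ) (x : X) : ℝ :=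
  (∑ l, ‖f l x‖ ^ q) ^ (1 / (q : ℝ))

/-- `T`, a bounded operator on `L^p`, is an extension of `D`, a bounded operator on `L^2`:
the two agree on every function of `L^2 ∩ L^p`. -/
def IsLpExtension {X : Type*} [MeasurableSpace X] {μ : Measure X} {p : ℝ≥0∞} [Fact (1 ≤ p)]
    (D : Lp ℂ 2 μ →L[ℂ] Lp ℂ 2 μ) (T : Lp ℂ p μ →L[ℂ] Lp ℂ p μ) : Prop :=
  ∀ (f : X → ℂ) (h2 : MemLp f 2 μ) (hp : MemLp f p μ), T (hp.toLp f) =ᵐ[μ] D (h2.toLp f)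

/-!
The square function estimate rests on three ideas.

*Superorthogonality and Newton's identities.* Let `z` be a finite complex family and
`x l = 2 Re (ω ^ k * z l)`, with `ω` a root of unity of order `2 * r + 1`. In the elementary
symmetric function of degree `2 * r` of `x`, summed over `k`, only products with `r` factors `z` and
`r` factors `conj z`, at distinct indices, survive (`ofReal_rotSymm`); these are exactly what type IV
superorthogonality integrates to zero (`TypeIVSuperorthogonal.integral_rotSymm`). For real `x`,
Newton's identities give the elementary symmetric function of degree `2 * r` the leading term
`(∑ x) ^ (2 * r)`, up to terms containing the square function (`exists_sum_pow_le`), and also the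
leading term `± (∑ x ^ 2) ^ r`, up to terms containing `∑ x` or `max |x|`
(`exists_square_pow_le`). Hence the square function and the `L^{2r}` norm of a superorthogonal sum
control each other, the former with the help of the `ℓ^{2r}` norm
(`exists_eLpNorm_sum_le_ellNorm`, `exists_eLpNorm_ellNorm_le`).

*Random signs.* Type IV superorthogonality is stable under multiplying the family by scalars. So
all operators `∑ ± Δ l` are bounded on `L^{2r}`, uniformly in the signs; Marcinkiewicz interpolation
(`marcinkiewicz_simpleFunc`) and duality, the operators being self-adjoint, give the same on every
`L^p`, `1 < p < ∞` (`IsSuperorthogonalDecomposition.exists_eLpNorm_signOp_le`). Khintchine's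
inequality turns this into the upper square function estimate.

*Duality.* Superorthogonality of order one says that the `Δ l` have pairwise orthogonal ranges
(`IsSuperorthogonalDecomposition.inner_eq_zero`), so `⟪f, g⟫ = ∑ ⟪Δ l f, Δ l g⟫`, and the lower
estimate on `L^p` follows from the upper one on the dual space.

All this is proved for simple functions and is carried over to `L^p` by density.
-/

/-! ### Elementary symmetric sums and power sums of real numbers -/

/-- The `n`-th elementary symmetric function of a finite family. -/
def elemSymm {ι R : Type*} [Fintype ι] [CommRing R] (x : ι → R) (n : ℕ) : R :=
  ∑ s ∈ Finset.powersetCard n Finset.univ, ∏ l ∈ s, x l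

theorem elemSymm_zero {ι R : Type*} [Fintype ι] [CommRing R] (x : ι → R) :
    elemSymm x 0 = 1 := by
  simp [elemSymm]

/-- Newton's identities. -/
theorem newton_elemSymm {ι R : Type*} [Fintype ι] [CommRing R] (x : ι → R) (n : ℕ) :
    ((n + 1 : ℕ) : R) * elemSymm x (n + 1) =
      ∑ j ∈ Finset.range (n + 1), (-1) ^ j * (∑ l, x l ^ (j + 1)) * elemSymm x (n - j) := by
  classical
  have h := congrArg (MvPolynomial.aeval x) (MvPolynomial.mul_esymm_eq_sum ι R (n + 1))
  have he : ∀ k, MvPolynomial.aeval x (MvPolynomial.esymm ι R k) = elemSymm x k := by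
    intro k
    simp [MvPolynomial.esymm, elemSymm, map_sum, map_prod]
  have hp : ∀ k, MvPolynomial.aeval x (MvPolynomial.psum ι R k) = ∑ l, x l ^ k := by
    intro k
    simp [MvPolynomial.psum, map_sum]
  simp only [map_mul, map_natCast, map_sum, map_pow, map_neg, map_one, he, hp] at h
  rw [h, Finset.sum_filter, Finset.Nat.sum_antidiagonal_eq_sum_range_succ_mk,
    Finset.sum_range_succ, if_neg (lt_irrefl _), add_zero, ← Finset.sum_range_reflect,
    Finset.mul_sum]
  refine Finset.sum_congr rfl fun j hj => ?_
  have hj' : j ≤ n := Nat.lt_succ_iff.mp (Finset.mem_range.mp hj)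
  have h1 : n + 1 - 1 - j = n - j := by omega
  have h2 : n + 1 - (n - j) = j + 1 := by omega
  have h3 : n - j < n + 1 := by omega
  rw [h1, if_pos h3, h2]
  have h4 : ((-1 : R)) ^ (n + 1 + 1) * (-1) ^ (n - j) = (-1) ^ j := by
    rw [← pow_add, show n + 1 + 1 + (n - j) = j + 2 * (n - j + 1) by omega, pow_add, pow_mul]
    simp
  rw [← h4]
  ring

/-- Size bounds on the power sums `P i` of a family, in terms of `u = |P 1|`, `σ = √(P 2)` and a
bound `q` for the entries, together with Newton's identities for the elementary symmetric
functions `e`. -/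
structure NewtonBound (e P : ℕ → ℝ) (u σ q : ℝ) : Prop where
  zero : e 0 = 1
  newton : ∀ n : ℕ, ((n + 1 : ℕ) : ℝ) * e (n + 1) =
    ∑ j ∈ Finset.range (n + 1), (-1) ^ j * P (j + 1) * e (n - j)
  u_eq : u = |P 1|
  σ_nonneg : 0 ≤ σ
  σ_sq : σ ^ 2 = P 2
  q_nonneg : 0 ≤ q
  q_le : q ≤ σ
  higher : ∀ i, |P (i + 3)| ≤ q * σ ^ (i + 2)

namespace NewtonBound

variable {e P : ℕ → ℝ} {u σ q : ℝ}

theorem u_nonneg (h : NewtonBound e P u σ q) : 0 ≤ u := h.u_eq ▸ abs_nonneg _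

theorem abs_P_le (h : NewtonBound e P u σ q) (i : ℕ) : |P (i + 1)| ≤ (u + σ) ^ (i + 1) := by
  have hu := h.u_nonneg
  have hσ := h.σ_nonneg
  have hM : σ ≤ u + σ := by linarith
  match i with
  | 0 => simp only [zero_add, pow_one]; rw [← h.u_eq]; linarith
  | 1 =>
    rw [show 1 + 1 = 2 from rfl, ← h.σ_sq, abs_of_nonneg (by positivity)]
    gcongr
  | i + 2 =>
    calc |P (i + 3)| ≤ q * σ ^ (i + 2) := h.higher i
      _ ≤ (u + σ) * (u + σ) ^ (i + 2) := by
        gcongr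
        exact h.q_le.trans hM
      _ = _ := by ring

theorem abs_e_le (h : NewtonBound e P u σ q) (n : ℕ) : |e n| ≤ (u + σ) ^ n := by
  have hM : 0 ≤ u + σ := add_nonneg h.u_nonneg h.σ_nonneg
  induction n using Nat.strong_induction_on with
  | _ n ih =>
    match n with
    | 0 => simp [h.zero]
    | n + 1 =>
      have h1 : ((n + 1 : ℕ) : ℝ) * |e (n + 1)| ≤ ((n + 1 : ℕ) : ℝ) * (u + σ) ^ (n + 1) := by
        rw [← abs_of_nonneg (Nat.cast_nonneg (α := ℝ) (n + 1)), ← abs_mul, h.newton n,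
          abs_of_nonneg (Nat.cast_nonneg (α := ℝ) (n + 1))]
        refine (Finset.abs_sum_le_sum_abs _ _).trans ?_
        refine (Finset.sum_le_card_nsmul _ _ ((u + σ) ^ (n + 1)) ?_).trans (by simp)
        intro j hj
        have hj' : j ≤ n := Nat.lt_succ_iff.mp (Finset.mem_range.mp hj)
        rw [abs_mul, abs_mul, abs_pow, abs_neg, abs_one, one_pow, one_mul]
        calc |P (j + 1)| * |e (n - j)| ≤ (u + σ) ^ (j + 1) * (u + σ) ^ (n - j) := by
              gcongr
              · exact h.abs_P_le j
              · exact ih _ (by omega)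
          _ = (u + σ) ^ (n + 1) := by
            rw [← pow_add]; congr 1; omega
      exact le_of_mul_le_mul_left h1 (by positivity)

/-- Newton's identity, truncated after the terms that contain `P 1` and `P 2`. -/
theorem abs_newton_sub_le (h : NewtonBound e P u σ q) (n : ℕ) :
    |((n + 2 : ℕ) : ℝ) * e (n + 2) - P 1 * e (n + 1) + P 2 * e n|
      ≤ n * q * (u + σ) ^ (n + 1) := by
  have hu := h.u_nonneg
  have hσ := h.σ_nonneg
  have hM : 0 ≤ u + σ := add_nonneg hu hσ
  have h1 : ((n + 2 : ℕ) : ℝ) * e (n + 2) - P 1 * e (n + 1) + P 2 * e n =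
      ∑ j ∈ Finset.range n, (-1) ^ (j + 1 + 1) * P (j + 3) * e (n + 1 - (j + 1 + 1)) := by
    rw [h.newton (n + 1), Finset.sum_range_succ', Finset.sum_range_succ']
    simp
  rw [h1]
  refine (Finset.abs_sum_le_sum_abs _ _).trans ?_
  refine (Finset.sum_le_card_nsmul _ _ (q * (u + σ) ^ (n + 1)) ?_).trans
    (by simp [mul_assoc])
  intro j hj
  have hj' : j < n := Finset.mem_range.mp hj
  rw [abs_mul, abs_mul, abs_pow, abs_neg, abs_one, one_pow, one_mul]
  calc |P (j + 3)| * |e (n + 1 - (j + 1 + 1))|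
      ≤ (q * (u + σ) ^ (j + 2)) * (u + σ) ^ (n + 1 - (j + 1 + 1)) := by
        have := h.q_nonneg
        gcongr
        · refine (h.higher j).trans ?_
          gcongr
          linarith
        · exact h.abs_e_le _
    _ = q * (u + σ) ^ (n + 1) := by
      rw [mul_assoc, ← pow_add]; congr 2; omega

/-- The leading term of `n! e n` is `(P 1) ^ n`. -/
theorem abs_factorial_mul_e_sub_le (h : NewtonBound e P u σ q) (n : ℕ) :
    |((n + 1).factorial : ℝ) * e (n + 1) - P 1 ^ (n + 1)|
      ≤ ((n + 1).factorial * n : ℝ) * (σ * (u + σ) ^ n) := by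
  have hu := h.u_nonneg
  have hσ := h.σ_nonneg
  have hq := h.q_nonneg
  have hM : 0 ≤ u + σ := add_nonneg hu hσ
  induction n with
  | zero =>
    have := h.newton 0
    simp [h.zero] at this
    simp [this]
  | succ n ih =>
    have h1 : |((n + 2 : ℕ) : ℝ) * e (n + 2) - P 1 * e (n + 1)|
        ≤ (n + 1) * (σ * (u + σ) ^ (n + 1)) := by
      have e1 : ((n + 2 : ℕ) : ℝ) * e (n + 2) - P 1 * e (n + 1) =
          (((n + 2 : ℕ) : ℝ) * e (n + 2) - P 1 * e (n + 1) + P 2 * e n) - P 2 * e n := by ring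
      rw [e1]
      refine (abs_sub _ _).trans ?_
      have h2 : |P 2 * e n| ≤ σ * (u + σ) ^ (n + 1) := by
        rw [abs_mul, ← h.σ_sq, abs_of_nonneg (by positivity)]
        calc σ ^ 2 * |e n| ≤ (σ * (u + σ)) * (u + σ) ^ n := by
              rw [pow_two]
              gcongr
              · linarith
              · exact h.abs_e_le n
          _ = _ := by ring
      have h3 : (n : ℝ) * q * (u + σ) ^ (n + 1) ≤ n * σ * (u + σ) ^ (n + 1) := by
        gcongr; exact h.q_le
      linarith [h.abs_newton_sub_le n]
    have e2 : ((n + 1 + 1).factorial : ℝ) * e (n + 1 + 1) - P 1 ^ (n + 1 + 1) =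
        ((n + 1).factorial : ℝ) * (((n + 2 : ℕ) : ℝ) * e (n + 2) - P 1 * e (n + 1)) +
          P 1 * (((n + 1).factorial : ℝ) * e (n + 1) - P 1 ^ (n + 1)) := by
      rw [Nat.factorial_succ (n + 1)]; push_cast; ring
    rw [e2]
    refine (abs_add_le _ _).trans ?_
    rw [abs_mul, abs_mul, ← h.u_eq, abs_of_nonneg (Nat.cast_nonneg _)]
    calc _ ≤ ((n + 1).factorial : ℝ) * ((n + 1) * (σ * (u + σ) ^ (n + 1))) +
          (u + σ) * (((n + 1).factorial * n : ℝ) * (σ * (u + σ) ^ n)) := by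
            gcongr
            linarith
      _ = ((n + 1).factorial * (2 * n + 1) : ℝ) * (σ * (u + σ) ^ (n + 1)) := by ring
      _ ≤ _ := by
        refine mul_le_mul_of_nonneg_right ?_ (by positivity)
        rw [Nat.factorial_succ (n + 1)]
        push_cast
        have : (0 : ℝ) ≤ (n + 1).factorial := by positivity
        have hn : (0 : ℝ) ≤ n := by positivity
        nlinarith [mul_nonneg this hn, mul_nonneg this (mul_nonneg hn hn)]

/-- Modulo terms containing `P 1` or the bound `q` for the entries,
`2 ^ m * m! * e (2 * m)` is `(- P 2) ^ m`. -/
theorem exists_abs_e_even_sub_le (m : ℕ) : ∃ C : ℝ, 0 ≤ C ∧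
    ∀ {e P : ℕ → ℝ} {u σ q : ℝ}, NewtonBound e P u σ q →
      |(2 ^ (m + 1) * (m + 1).factorial : ℝ) * e (2 * m + 2) - (-P 2) ^ (m + 1)|
        ≤ C * ((u + q) * (u + σ) ^ (2 * m + 1)) := by
  have step : ∀ (n : ℕ) {e P : ℕ → ℝ} {u σ q : ℝ}, NewtonBound e P u σ q →
      |((n + 2 : ℕ) : ℝ) * e (n + 2) + P 2 * e n|
        ≤ (n + 1) * ((u + q) * (u + σ) ^ (n + 1)) := by
    intro n e P u σ q h
    have hu := h.u_nonneg
    have hσ := h.σ_nonneg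
    have hq := h.q_nonneg
    have hM : 0 ≤ u + σ := add_nonneg hu hσ
    have e1 : ((n + 2 : ℕ) : ℝ) * e (n + 2) + P 2 * e n =
        (((n + 2 : ℕ) : ℝ) * e (n + 2) - P 1 * e (n + 1) + P 2 * e n) + P 1 * e (n + 1) := by ring
    rw [e1]
    refine (abs_add_le _ _).trans ?_
    have h2 : |P 1 * e (n + 1)| ≤ u * (u + σ) ^ (n + 1) := by
      rw [abs_mul, ← h.u_eq]
      gcongr
      exact h.abs_e_le _
    have h3 : 0 ≤ (u + σ) ^ (n + 1) := by positivity
    have h4 : 0 ≤ n * u * (u + σ) ^ (n + 1) := by positivity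
    have h5 : 0 ≤ q * (u + σ) ^ (n + 1) := by positivity
    linarith [h.abs_newton_sub_le n]
  induction m with
  | zero =>
    refine ⟨1, zero_le_one, fun h => ?_⟩
    have := step 0 h
    simp [h.zero] at this
    simpa using this
  | succ m ih =>
    obtain ⟨C, hC, ih⟩ := ih
    refine ⟨(2 ^ (m + 1) * (m + 1).factorial : ℝ) * (2 * m + 3) + C, by positivity, ?_⟩
    intro e P u σ q h
    have hu := h.u_nonneg
    have hσ := h.σ_nonneg
    have hq := h.q_nonneg
    have hM : 0 ≤ u + σ := add_nonneg hu hσ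
    have e2 : (2 ^ (m + 1 + 1) * (m + 1 + 1).factorial : ℝ) * e (2 * (m + 1) + 2)
          - (-P 2) ^ (m + 1 + 1) =
        (2 ^ (m + 1) * (m + 1).factorial : ℝ) *
          (((2 * m + 2 + 2 : ℕ) : ℝ) * e (2 * m + 2 + 2) + P 2 * e (2 * m + 2)) +
        (-P 2) * ((2 ^ (m + 1) * (m + 1).factorial : ℝ) * e (2 * m + 2) - (-P 2) ^ (m + 1)) := by
      rw [Nat.factorial_succ (m + 1), show 2 * (m + 1) + 2 = 2 * m + 2 + 2 by ring]
      push_cast; ring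
    rw [e2]
    refine (abs_add_le _ _).trans ?_
    have h1 := step (2 * m + 2) h
    have h2 := ih h
    rw [← h.σ_sq] at h1 h2 ⊢
    rw [abs_mul, abs_mul (-σ ^ 2), abs_neg, abs_of_nonneg (by positivity : 0 ≤ σ ^ 2),
      abs_of_nonneg (by positivity : (0 : ℝ) ≤ 2 ^ (m + 1) * (m + 1).factorial)]
    push_cast at h1
    calc _ ≤ (2 ^ (m + 1) * (m + 1).factorial : ℝ) *
            ((2 * m + 2 + 1) * ((u + q) * (u + σ) ^ (2 * m + 2 + 1))) +
          (u + σ) ^ 2 * (C * ((u + q) * (u + σ) ^ (2 * m + 1))) := by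
            gcongr
            · push_cast; exact h1
            · linarith
      _ = _ := by ring

end NewtonBound

/-- Absorption: a term `b * (a + b) ^ n` is at most a small multiple of `a ^ (n + 1)` plus a
large multiple of `b ^ (n + 1)`. -/
theorem exists_mul_add_pow_le (C : ℝ) (hC : 0 ≤ C) (n : ℕ) : ∃ K : ℝ, 0 ≤ K ∧
    ∀ a b : ℝ, 0 ≤ a → 0 ≤ b →
      C * (b * (a + b) ^ n) ≤ a ^ (n + 1) / 2 + K * b ^ (n + 1) := by
  obtain ⟨t, ht⟩ : ∃ t, t = C * 2 ^ (n + 1) + 1 := ⟨_, rfl⟩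
  have ht1 : 1 ≤ t := by
    rw [ht]
    have : 0 ≤ C * 2 ^ (n + 1) := by positivity
    linarith
  refine ⟨C * (t + 1) ^ n, by positivity, fun a b ha hb => ?_⟩
  rcases le_total a (t * b) with h | h
  · have h1 : C * (b * (a + b) ^ n) ≤ C * (b * ((t + 1) * b) ^ n) := by
      gcongr
      linarith
    have h2 : C * (b * ((t + 1) * b) ^ n) = C * (t + 1) ^ n * b ^ (n + 1) := by
      rw [mul_pow]; ring
    have h3 : 0 ≤ a ^ (n + 1) / 2 := by positivity
    linarith
  · have hba : b ≤ a := le_trans (le_mul_of_one_le_left hb ht1) h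
    have h1 : C * (b * (a + b) ^ n) ≤ C * (b * (2 * a) ^ n) := by
      gcongr
      linarith
    have h2 : C * (b * (2 * a) ^ n) = (C * 2 ^ (n + 1) * b) * a ^ n / 2 := by
      rw [mul_pow]; ring
    have h3 : (C * 2 ^ (n + 1) * b) * a ^ n / 2 ≤ a * a ^ n / 2 := by
      gcongr
      refine le_trans ?_ h
      gcongr
      linarith
    have h4 : a * a ^ n / 2 = a ^ (n + 1) / 2 := by ring
    have h5 : 0 ≤ C * (t + 1) ^ n * b ^ (n + 1) := by positivity
    linarith

/-- The hypotheses on the power sums hold for every real family, with `q` its sup norm, which is in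
turn bounded by the `ℓ^{2r}` norms. -/
theorem exists_newtonBound {ι : Type*} [Fintype ι] (x : ι → ℝ) : ∃ q : ℝ,
    NewtonBound (elemSymm x) (fun i => ∑ l, x l ^ i) |∑ l, x l| (√(∑ l, x l ^ 2)) q ∧
      ∀ r : ℕ, r ≠ 0 → q ^ (2 * r) ≤ ∑ l, x l ^ (2 * r) := by
  have hq : ∀ l, |x l| ≤ ((Finset.univ.sup fun l => ‖x l‖₊ : ℝ≥0) : ℝ) := by
    intro l
    have := Finset.le_sup (f := fun l => ‖x l‖₊) (Finset.mem_univ l)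
    exact_mod_cast this
  have hq2 : ∀ r : ℕ, r ≠ 0 →
      ((Finset.univ.sup fun l => ‖x l‖₊ : ℝ≥0) : ℝ) ^ (2 * r) ≤ ∑ l, x l ^ (2 * r) := by
    intro r hr
    rcases isEmpty_or_nonempty ι with h | h
    · simp [hr]
    · obtain ⟨l, -, hl⟩ := Finset.exists_mem_eq_sup (Finset.univ : Finset ι)
        Finset.univ_nonempty (fun l => ‖x l‖₊)
      rw [hl]
      have : ((‖x l‖₊ : ℝ≥0) : ℝ) ^ (2 * r) = x l ^ (2 * r) := by
        rw [coe_nnnorm, Real.norm_eq_abs, pow_mul, sq_abs, pow_mul]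
      rw [this]
      exact Finset.single_le_sum (f := fun l => x l ^ (2 * r))
        (fun i _ => by rw [pow_mul]; positivity) (Finset.mem_univ l)
  generalize ((Finset.univ.sup fun l => ‖x l‖₊ : ℝ≥0) : ℝ) = q at hq hq2
  rcases isEmpty_or_nonempty ι with h | h
  · refine ⟨0, ⟨elemSymm_zero x, newton_elemSymm x, by simp, by simp, by simp, le_rfl,
      by simp, by simp⟩, fun r hr => by simp [hr]⟩
  have hq0 : 0 ≤ q := (abs_nonneg _).trans (hq (Classical.arbitrary ι))
  have hS : 0 ≤ ∑ l, x l ^ 2 := Finset.sum_nonneg fun l _ => sq_nonneg _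
  have hqσ : q ≤ √(∑ l, x l ^ 2) := Real.le_sqrt_of_sq_le (hq2 1 one_ne_zero)
  refine ⟨q, ⟨elemSymm_zero x, newton_elemSymm x, by simp, by positivity, Real.sq_sqrt hS, hq0,
    hqσ, fun i => ?_⟩, hq2⟩
  calc |∑ l, x l ^ (i + 3)| ≤ ∑ l, |x l ^ (i + 3)| := Finset.abs_sum_le_sum_abs _ _
    _ ≤ ∑ l, q ^ (i + 1) * x l ^ 2 := by
      refine Finset.sum_le_sum fun l _ => ?_
      rw [abs_pow, ← sq_abs (x l), show i + 3 = (i + 1) + 2 by ring, pow_add]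
      gcongr
      exact hq l
    _ = q * (q ^ i * √(∑ l, x l ^ 2) ^ 2) := by
      rw [Real.sq_sqrt hS, ← Finset.mul_sum]; ring
    _ ≤ q * (√(∑ l, x l ^ 2) ^ i * √(∑ l, x l ^ 2) ^ 2) := by gcongr
    _ = _ := by ring

/-- The sum of a finite real family is controlled, at the power `2 * r`, by the square function
and the elementary symmetric function of degree `2 * r`. -/
theorem exists_sum_pow_le (r : ℕ) (hr : r ≠ 0) : ∃ a C : ℝ, 0 ≤ C ∧
    ∀ {ι : Type*} [Fintype ι] (x : ι → ℝ),
      (∑ l, x l) ^ (2 * r) ≤ a * elemSymm x (2 * r) + C * (∑ l, x l ^ 2) ^ r := by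
  obtain ⟨n, hn⟩ : ∃ n, 2 * r = n + 1 := ⟨2 * r - 1, by omega⟩
  obtain ⟨K, hK, H⟩ := exists_mul_add_pow_le ((n + 1).factorial * n : ℝ) (by positivity) n
  refine ⟨2 * (n + 1).factorial, 2 * K, by positivity, fun x => ?_⟩
  obtain ⟨q, hq, -⟩ := exists_newtonBound x
  have h1 := hq.abs_factorial_mul_e_sub_le n
  have h2 := H |∑ l, x l| (√(∑ l, x l ^ 2)) (abs_nonneg _) (by positivity)
  have h3 : |∑ l, x l| ^ (n + 1) = (∑ l, x l) ^ (2 * r) := by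
    rw [← hn, pow_mul, sq_abs, pow_mul]
  have h4 : √(∑ l, x l ^ 2) ^ (n + 1) = (∑ l, x l ^ 2) ^ r := by
    rw [← hn, pow_mul, Real.sq_sqrt (Finset.sum_nonneg fun l _ => sq_nonneg _)]
  rw [h3, h4] at h2
  have h5 := (abs_le.mp (h1.trans h2)).1
  simp only [pow_one] at h5
  rw [← hn] at h5 ⊢
  linarith

/-- The square function of a finite real family is controlled, at the power `2 * r`, by the sum,
the `ℓ^{2r}` norm and the elementary symmetric function of degree `2 * r`. -/
theorem exists_square_pow_le (r : ℕ) (hr : r ≠ 0) : ∃ b C : ℝ, 0 ≤ C ∧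
    ∀ {ι : Type*} [Fintype ι] (x : ι → ℝ),
      (∑ l, x l ^ 2) ^ r ≤ b * elemSymm x (2 * r) +
        C * ((∑ l, x l) ^ (2 * r) + ∑ l, x l ^ (2 * r)) := by
  obtain ⟨m, rfl⟩ : ∃ m, r = m + 1 := ⟨r - 1, by omega⟩
  obtain ⟨C, hC, hE⟩ := NewtonBound.exists_abs_e_even_sub_le m
  obtain ⟨K, hK, H⟩ := exists_mul_add_pow_le C hC (2 * m + 1)
  refine ⟨2 * ((-1) ^ (m + 1) * (2 ^ (m + 1) * (m + 1).factorial)),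
    2 * (K * 2 ^ (2 * m + 1)), by positivity, fun x => ?_⟩
  obtain ⟨q, hq, hq2⟩ := exists_newtonBound x
  have hS : 0 ≤ ∑ l, x l ^ 2 := Finset.sum_nonneg fun l _ => sq_nonneg _
  have h1 := hE hq
  have hu := hq.u_nonneg
  have hq0 := hq.q_nonneg
  have hσ := hq.σ_nonneg
  generalize hs : √(∑ l, x l ^ 2) = σ at *
  have h2 := H σ (|∑ l, x l| + q) hσ (by positivity)
  have h2' : C * ((|∑ l, x l| + q) * (|∑ l, x l| + σ) ^ (2 * m + 1)) ≤
      C * ((|∑ l, x l| + q) * (σ + (|∑ l, x l| + q)) ^ (2 * m + 1)) := by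
    gcongr ?_ * (?_ * ?_ ^ _)
    linarith
  have h3 := add_pow_le hu hq0 (2 * m + 2)
  have h4 : |∑ l, x l| ^ (2 * m + 2) = (∑ l, x l) ^ (2 * (m + 1)) := by
    rw [show 2 * m + 2 = 2 * (m + 1) by ring, pow_mul, sq_abs, pow_mul]
  have h5 : σ ^ (2 * m + 2) = (∑ l, x l ^ 2) ^ (m + 1) := by
    rw [← hs, show 2 * m + 2 = 2 * (m + 1) by ring, pow_mul, Real.sq_sqrt hS]
  have h6 := hq2 (m + 1) (by omega)
  rw [show 2 * m + 1 + 1 = 2 * m + 2 by ring, h5] at h2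
  rw [h4, show 2 * m + 2 - 1 = 2 * m + 1 by omega] at h3
  rw [show 2 * (m + 1) = 2 * m + 2 by ring] at *
  have h7 := abs_le.mp ((h1.trans h2').trans h2)
  have h8 : K * (|∑ l, x l| + q) ^ (2 * m + 2) ≤
      K * (2 ^ (2 * m + 1) * ((∑ l, x l) ^ (2 * m + 2) + ∑ l, x l ^ (2 * m + 2))) := by
    refine mul_le_mul_of_nonneg_left (h3.trans ?_) hK
    gcongr
  -- multiply by the sign `(-1) ^ (m + 1)`
  have h9 : (-(∑ l, x l ^ 2)) ^ (m + 1) = (-1) ^ (m + 1) * (∑ l, x l ^ 2) ^ (m + 1) := by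
    rw [← mul_pow]; ring
  rw [h9] at h7
  rcases neg_one_pow_eq_or ℝ (m + 1) with hs1 | hs1 <;> rw [hs1] at h7 ⊢ <;> linarith [h7.1, h7.2]

/-! ### Square function estimates from superorthogonality -/

/-- The root of unity `exp (2πi / (2r + 1))`. Its order exceeds `2 * r`, the degree of the products
to be averaged, so that only balanced products survive. -/
noncomputable def rotRoot (r : ℕ) : ℂ :=
  Complex.exp (2 * Real.pi * Complex.I / ((2 * r + 1 : ℕ) : ℂ))

theorem isPrimitiveRoot_rotRoot (r : ℕ) : IsPrimitiveRoot (rotRoot r) (2 * r + 1) :=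
  Complex.isPrimitiveRoot_exp _ (by omega)

theorem conj_rotRoot (r : ℕ) : conj (rotRoot r) = (rotRoot r)⁻¹ :=
  (Complex.inv_eq_conj ((isPrimitiveRoot_rotRoot r).norm'_eq_one (by omega))).symm

theorem norm_rotRoot (r : ℕ) : ‖rotRoot r‖ = 1 :=
  (isPrimitiveRoot_rotRoot r).norm'_eq_one (by omega)

theorem sum_rotRoot_pow_mul (r i j : ℕ) (hi : i ≤ 2 * r) (hj : j ≤ 2 * r) :
    ∑ k ∈ Finset.range (2 * r + 1), (rotRoot r ^ k) ^ i * (conj (rotRoot r ^ k)) ^ j =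
      if i = j then ((2 * r + 1 : ℕ) : ℂ) else 0 := by
  have h := isPrimitiveRoot_rotRoot r
  have h0 : rotRoot r ≠ 0 := h.ne_zero (by omega)
  have h1 : ∀ k, (rotRoot r ^ k) ^ i * (conj (rotRoot r ^ k)) ^ j =
      (rotRoot r ^ i * (rotRoot r ^ j)⁻¹) ^ k := by
    intro k
    rw [map_pow, conj_rotRoot]
    simp only [inv_pow, mul_pow, ← pow_mul, mul_comm]
  simp only [h1]
  split_ifs with hij
  · subst hij
    simp [mul_inv_cancel₀ (pow_ne_zero i h0)]
  · have hne : rotRoot r ^ i * (rotRoot r ^ j)⁻¹ - 1 ≠ 0 := by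
      intro h2
      rw [sub_eq_zero, mul_inv_eq_one₀ (pow_ne_zero j h0)] at h2
      exact hij (h.pow_inj (by omega) (by omega) h2)
    have h3 := geom_sum_mul (rotRoot r ^ i * (rotRoot r ^ j)⁻¹) (2 * r + 1)
    have h4 : (rotRoot r ^ i * (rotRoot r ^ j)⁻¹) ^ (2 * r + 1) = 1 := by
      rw [mul_pow, inv_pow, ← pow_mul, ← pow_mul, mul_comm i, mul_comm j, pow_mul, pow_mul,
        h.pow_eq_one]
      simp
    rw [h4, sub_self] at h3
    exact (mul_eq_zero.mp h3).resolve_right hne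

/-- Twice the real part of the family `z`, rotated by the `k`-th power of the root of unity. -/
noncomputable def rotRe (r : ℕ) {ι : Type*} (z : ι → ℂ) (k : ℕ) (l : ι) : ℝ :=
  2 * (rotRoot r ^ k * z l).re

theorem ofReal_rotRe (r : ℕ) {ι : Type*} (z : ι → ℂ) (k : ℕ) (l : ι) :
    (rotRe r z k l : ℂ) = rotRoot r ^ k * z l + conj (rotRoot r ^ k) * conj (z l) := by
  rw [rotRe, ← map_mul, Complex.add_conj]

theorem abs_rotRe_le (r : ℕ) {ι : Type*} (z : ι → ℂ) (k : ℕ) (l : ι) :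
    |rotRe r z k l| ≤ 2 * ‖z l‖ := by
  have h := Complex.abs_re_le_norm (rotRoot r ^ k * z l)
  rw [norm_mul, norm_pow, norm_rotRoot, one_pow, one_mul] at h
  rw [rotRe, abs_mul, abs_two]
  linarith

theorem sum_rotRe (r : ℕ) {ι : Type*} [Fintype ι] (z : ι → ℂ) (k : ℕ) :
    ∑ l, rotRe r z k l = rotRe r (fun _ : Unit => ∑ l, z l) k () := by
  simp [rotRe, ← Finset.mul_sum]

theorem sum_rotRe_sq (r : ℕ) (hr : r ≠ 0) {ι : Type*} (z : ι → ℂ) (l : ι) :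
    ∑ k ∈ Finset.range (2 * r + 1), rotRe r z k l ^ 2 = 2 * (2 * r + 1 : ℕ) * ‖z l‖ ^ 2 := by
  have h1 : ∀ k, ((rotRe r z k l ^ 2 : ℝ) : ℂ) =
      (rotRoot r ^ k) ^ 2 * (conj (rotRoot r ^ k)) ^ 0 * z l ^ 2 +
      (rotRoot r ^ k) ^ 0 * (conj (rotRoot r ^ k)) ^ 2 * conj (z l) ^ 2 +
      (rotRoot r ^ k) ^ 1 * (conj (rotRoot r ^ k)) ^ 1 * (2 * (z l * conj (z l))) := by
    intro k
    push_cast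
    rw [ofReal_rotRe]
    ring
  have h2 : ((∑ k ∈ Finset.range (2 * r + 1), rotRe r z k l ^ 2 : ℝ) : ℂ) =
      ((2 * (2 * r + 1 : ℕ) * ‖z l‖ ^ 2 : ℝ) : ℂ) := by
    rw [Complex.ofReal_sum]
    simp only [h1, Finset.sum_add_distrib, ← Finset.sum_mul]
    rw [sum_rotRoot_pow_mul r 2 0 (by omega) (by omega),
      sum_rotRoot_pow_mul r 0 2 (by omega) (by omega),
      sum_rotRoot_pow_mul r 1 1 (by omega) (by omega), Complex.mul_conj']
    push_cast
    simp
    ring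
  exact_mod_cast h2

/-- The elementary symmetric function of degree `2 * r` of the rotated real parts, summed over all
rotations. -/
noncomputable def rotSymm (r : ℕ) {ι : Type*} [Fintype ι] (z : ι → ℂ) : ℝ :=
  ∑ k ∈ Finset.range (2 * r + 1), elemSymm (rotRe r z k) (2 * r)

/-- Averaging over the rotations leaves only the products with as many factors `z` as factors
`conj z`. -/
theorem ofReal_rotSymm (r : ℕ) {ι : Type*} [Fintype ι] [DecidableEq ι] (z : ι → ℂ) :
    (rotSymm r z : ℂ) = ∑ s ∈ Finset.powersetCard (2 * r) (Finset.univ : Finset ι),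
      ∑ t ∈ s.powerset, (if t.card = (s \ t).card then ((2 * r + 1 : ℕ) : ℂ) else 0) *
        ((∏ l ∈ t, z l) * ∏ l ∈ s \ t, conj (z l)) := by
  rw [rotSymm, Complex.ofReal_sum]
  simp only [elemSymm, Complex.ofReal_sum, Complex.ofReal_prod, ofReal_rotRe]
  rw [Finset.sum_comm]
  refine Finset.sum_congr rfl fun s hs => ?_
  have hs' : s.card = 2 * r := (Finset.mem_powersetCard.mp hs).2
  simp only [Finset.prod_add]
  rw [Finset.sum_comm]
  refine Finset.sum_congr rfl fun t ht => ?_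
  have ht' : t ⊆ s := Finset.mem_powerset.mp ht
  rw [← sum_rotRoot_pow_mul r t.card (s \ t).card
    (hs' ▸ Finset.card_le_card ht') (hs' ▸ Finset.card_le_card Finset.sdiff_subset),
    Finset.sum_mul]
  refine Finset.sum_congr rfl fun k _ => ?_
  simp only [Finset.prod_mul_distrib, Finset.prod_const]
  ring

/-- A lower bound for the average of nonnegative reals, raised to a power, is at most the sum of
their powers. -/
theorem pow_le_sum_pow_of_le_sum {n r : ℕ} {c : ℝ} (hc : 0 ≤ c) (a : ℕ → ℝ)
    (ha : ∀ k, 0 ≤ a k) (h : (n + 1 : ℕ) * c ≤ ∑ k ∈ Finset.range (n + 1), a k) :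
    c ^ r ≤ ∑ k ∈ Finset.range (n + 1), a k ^ r := by
  obtain ⟨k, hk, hck⟩ := Finset.exists_le_of_sum_le (s := Finset.range (n + 1))
    (f := fun _ => c) (g := a) ⟨0, by simp⟩ (by simpa using h)
  exact (pow_le_pow_left₀ hc hck r).trans
    (Finset.single_le_sum (f := fun k => a k ^ r) (fun i _ => pow_nonneg (ha i) r) hk)

/-- Complex version of `exists_sum_pow_le`, averaged over the rotations. -/
theorem exists_norm_sum_pow_le (r : ℕ) (hr : r ≠ 0) : ∃ a C : ℝ, 0 ≤ C ∧
    ∀ {ι : Type*} [Fintype ι] (z : ι → ℂ),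
      ‖∑ l, z l‖ ^ (2 * r) ≤ a * rotSymm r z + C * (∑ l, ‖z l‖ ^ 2) ^ r := by
  obtain ⟨a, C, hC, H⟩ := exists_sum_pow_le r hr
  refine ⟨a, (2 * r + 1 : ℕ) * (C * 4 ^ r), by positivity, fun {ι} _ z => ?_⟩
  have h1 : ‖∑ l, z l‖ ^ (2 * r) ≤
      ∑ k ∈ Finset.range (2 * r + 1), (∑ l, rotRe r z k l) ^ (2 * r) := by
    simp only [pow_mul, sum_rotRe]
    refine pow_le_sum_pow_of_le_sum (by positivity) _ (fun k => sq_nonneg _) ?_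
    rw [sum_rotRe_sq r hr]
    have : 0 ≤ ((2 * r + 1 : ℕ) : ℝ) * ‖∑ l, z l‖ ^ 2 := by positivity
    linarith
  have h2 : ∀ k ∈ Finset.range (2 * r + 1), (∑ l, rotRe r z k l) ^ (2 * r) ≤
      a * elemSymm (rotRe r z k) (2 * r) + C * 4 ^ r * (∑ l, ‖z l‖ ^ 2) ^ r := by
    intro k _
    refine (H (rotRe r z k)).trans ?_
    rw [mul_assoc, ← mul_pow]
    gcongr
    rw [Finset.mul_sum]
    refine Finset.sum_le_sum fun l _ => ?_
    rw [← sq_abs]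
    calc |rotRe r z k l| ^ 2 ≤ (2 * ‖z l‖) ^ 2 := by gcongr; exact abs_rotRe_le r z k l
      _ = _ := by ring
  refine (h1.trans (Finset.sum_le_sum h2)).trans_eq ?_
  rw [Finset.sum_add_distrib, ← Finset.mul_sum, rotSymm]
  simp
  ring

/-- Complex version of `exists_square_pow_le`, averaged over the rotations. -/
theorem exists_norm_square_pow_le (r : ℕ) (hr : r ≠ 0) : ∃ b C : ℝ, 0 ≤ C ∧
    ∀ {ι : Type*} [Fintype ι] (z : ι → ℂ),
      (∑ l, ‖z l‖ ^ 2) ^ r ≤ b * rotSymm r z +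
        C * (‖∑ l, z l‖ ^ (2 * r) + ∑ l, ‖z l‖ ^ (2 * r)) := by
  obtain ⟨b, C, hC, H⟩ := exists_square_pow_le r hr
  refine ⟨b, (2 * r + 1 : ℕ) * (C * 2 ^ (2 * r)), by positivity, fun {ι} _ z => ?_⟩
  have h1 : (∑ l, ‖z l‖ ^ 2) ^ r ≤
      ∑ k ∈ Finset.range (2 * r + 1), (∑ l, rotRe r z k l ^ 2) ^ r := by
    refine pow_le_sum_pow_of_le_sum (Finset.sum_nonneg fun l _ => by positivity) _
      (fun k => Finset.sum_nonneg fun l _ => sq_nonneg _) ?_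
    rw [Finset.sum_comm]
    simp only [sum_rotRe_sq r hr]
    rw [← Finset.mul_sum]
    have : 0 ≤ ((2 * r + 1 : ℕ) : ℝ) * ∑ l, ‖z l‖ ^ 2 :=
      mul_nonneg (by positivity) (Finset.sum_nonneg fun l _ => by positivity)
    linarith
  have habs : ∀ {κ : Type _} (w : κ → ℂ) (k : ℕ) (l : κ),
      rotRe r w k l ^ (2 * r) ≤ 2 ^ (2 * r) * ‖w l‖ ^ (2 * r) := by
    intro κ w k l
    rw [← mul_pow, ← Even.pow_abs (even_two_mul r)]
    gcongr
    exact abs_rotRe_le r w k l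
  have h2 : ∀ k ∈ Finset.range (2 * r + 1), (∑ l, rotRe r z k l ^ 2) ^ r ≤
      b * elemSymm (rotRe r z k) (2 * r) +
        C * 2 ^ (2 * r) * (‖∑ l, z l‖ ^ (2 * r) + ∑ l, ‖z l‖ ^ (2 * r)) := by
    intro k _
    refine (H (rotRe r z k)).trans ?_
    rw [mul_assoc C, mul_add (2 ^ (2 * r) : ℝ), Finset.mul_sum]
    gcongr
    · rw [sum_rotRe, ← mul_pow, ← Even.pow_abs (even_two_mul r)]
      gcongr
      exact abs_rotRe_le r _ k _
    · exact habs z k _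
  refine (h1.trans (Finset.sum_le_sum h2)).trans_eq ?_
  rw [Finset.sum_add_distrib, ← Finset.mul_sum, rotSymm]
  simp
  ring

theorem ellNorm_nonneg {X : Type*} {L : ℕ} (q : ℕ) (f : Fin L → X → ℂ) (x : X) :
    0 ≤ ellNorm q f x :=
  Real.rpow_nonneg (Finset.sum_nonneg fun l _ => by positivity) _

theorem ellNorm_pow {X : Type*} {L q : ℕ} (hq : q ≠ 0) (f : Fin L → X → ℂ) (x : X) :
    ellNorm q f x ^ q = ∑ l, ‖f l x‖ ^ q := by
  rw [ellNorm, one_div, Real.rpow_inv_natCast_pow _ hq]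
  exact Finset.sum_nonneg fun l _ => by positivity

theorem ellNorm_le_sum {X : Type*} {L q : ℕ} (hq : q ≠ 0) (f : Fin L → X → ℂ) (x : X) :
    ellNorm q f x ≤ ∑ l, ‖f l x‖ := by
  refine le_of_pow_le_pow_left₀ hq (Finset.sum_nonneg fun l _ => norm_nonneg _) ?_
  rw [ellNorm_pow hq]
  obtain ⟨m, rfl⟩ : ∃ m, q = m + 1 := ⟨q - 1, by omega⟩
  rw [pow_succ', Finset.sum_mul]
  refine Finset.sum_le_sum fun l _ => ?_
  rw [pow_succ']
  gcongr
  exact Finset.single_le_sum (f := fun l => ‖f l x‖) (fun i _ => norm_nonneg _)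
    (Finset.mem_univ l)

section Integrals

variable {X : Type*} [MeasurableSpace X] {μ : Measure X} {r L : ℕ} {f : Fin L → X → ℂ}

/-- Type IV superorthogonality in terms of disjoint index sets: one indexes the factors `f`, the
other one the factors `conj f`. -/
theorem TypeIVSuperorthogonal.integral_prod_eq_zero (h : TypeIVSuperorthogonal μ r f)
    {t s : Finset (Fin L)} (hts : Disjoint t s) (ht : t.card = r) (hs : s.card = r) :
    ∫ x, (∏ l ∈ t, f l x) * ∏ l ∈ s, conj (f l x) ∂μ = 0 := by
  let a : Fin r ≃ t := (t.equivFinOfCardEq ht).symm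
  let b : Fin r ≃ s := (s.equivFinOfCardEq hs).symm
  let c : Fin (2 * r) → Fin L := fun m =>
    if (m : ℕ) % 2 = 0 then a ⟨m / 2, by omega⟩ else b ⟨m / 2, by omega⟩
  have hc : Function.Injective c := by
    intro m n hmn
    have key : ∀ i j, (a i : Fin L) ≠ b j := fun i j =>
      Finset.disjoint_left.mp hts |> fun h e => h (a i).2 (e ▸ (b j).2)
    simp only [c] at hmn
    split_ifs at hmn with h1 h2 h2
    · have := Fin.mk.inj_iff.mp (a.injective (Subtype.ext hmn))
      exact Fin.ext (by omega)
    · exact absurd hmn (key _ _)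
    · exact absurd hmn.symm (key _ _)
    · have := Fin.mk.inj_iff.mp (b.injective (Subtype.ext hmn))
      exact Fin.ext (by omega)
  rw [← h c hc]
  congr 1
  ext x
  have e1 : ∏ l ∈ t, f l x = ∏ j, f (a j) x := by
    rw [← Finset.prod_coe_sort t (fun l => f l x)]
    exact (Equiv.prod_comp a (fun l : t => f l x)).symm
  have e2 : ∏ l ∈ s, conj (f l x) = ∏ j, conj (f (b j) x) := by
    rw [← Finset.prod_coe_sort s (fun l => conj (f l x))]
    exact (Equiv.prod_comp b (fun l : s => conj (f l x))).symm
  rw [e1, e2, ← Finset.prod_mul_distrib]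
  refine Finset.prod_congr rfl fun j _ => ?_
  have e3 : c ⟨2 * (j : ℕ), by omega⟩ = a j := by simp [c]
  have e4 : c ⟨2 * (j : ℕ) + 1, by omega⟩ = b j := by
    have : (2 * (j : ℕ) + 1) / 2 = j := by omega
    simp [c, Nat.add_mod, this]
  rw [e3, e4]

theorem integrable_prod_mul_prod_conj (hr : r ≠ 0)
    (hf : ∀ l, MemLp (f l) ((2 * r : ℕ) : ℝ≥0∞) μ) {t s : Finset (Fin L)}
    (ht : t ⊆ s) (hs : s.card = 2 * r) :
    Integrable (fun x => (∏ l ∈ t, f l x) * ∏ l ∈ s \ t, conj (f l x)) μ := by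
  have h1 := MemLp.prod' (s := s) (f := fun l x => if l ∈ t then f l x else conj (f l x))
    (p := fun _ => ((2 * r : ℕ) : ℝ≥0∞)) (μ := μ) (fun l _ => by
      by_cases hl : l ∈ t
      · simpa [hl] using hf l
      · simp only [hl, if_false]
        exact (hf l).star)
  have h2 : (∑ _i ∈ s, (((2 * r : ℕ) : ℝ≥0∞))⁻¹)⁻¹ = 1 := by
    rw [Finset.sum_const, hs, nsmul_eq_mul, ENNReal.mul_inv_cancel, inv_one]
    · exact_mod_cast (by omega : 2 * r ≠ 0)
    · exact ENNReal.natCast_ne_top _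
  rw [h2, memLp_one_iff_integrable] at h1
  refine h1.congr (Filter.Eventually.of_forall fun x => ?_)
  simp only
  rw [← Finset.prod_sdiff ht, mul_comm]
  congr 1
  · exact Finset.prod_congr rfl fun l hl => if_pos hl
  · exact Finset.prod_congr rfl fun l hl => if_neg (Finset.mem_sdiff.mp hl).2

theorem integrable_ofReal_rotSymm (hr : r ≠ 0)
    (hf : ∀ l, MemLp (f l) ((2 * r : ℕ) : ℝ≥0∞) μ) :
    Integrable (fun x => (rotSymm r (fun l => f l x) : ℂ)) μ := by
  simp only [ofReal_rotSymm]
  refine integrable_finsetSum _ fun s hs => integrable_finsetSum _ fun t ht => ?_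
  exact (integrable_prod_mul_prod_conj hr hf (Finset.mem_powerset.mp ht)
    (Finset.mem_powersetCard.mp hs).2).const_mul _

theorem integrable_rotSymm (hr : r ≠ 0)
    (hf : ∀ l, MemLp (f l) ((2 * r : ℕ) : ℝ≥0∞) μ) :
    Integrable (fun x => rotSymm r (fun l => f l x)) μ := by
  simpa using (integrable_ofReal_rotSymm hr hf).re

theorem TypeIVSuperorthogonal.integral_rotSymm (h : TypeIVSuperorthogonal μ r f) (hr : r ≠ 0)
    (hf : ∀ l, MemLp (f l) ((2 * r : ℕ) : ℝ≥0∞) μ) :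
    ∫ x, rotSymm r (fun l => f l x) ∂μ = 0 := by
  have h1 : ((∫ x, rotSymm r (fun l => f l x) ∂μ : ℝ) : ℂ) = 0 := by
    rw [← integral_complex_ofReal]
    simp only [ofReal_rotSymm]
    have hint : ∀ s ∈ Finset.powersetCard (2 * r) (Finset.univ : Finset (Fin L)),
        ∀ t ∈ s.powerset, Integrable (fun x =>
          (if t.card = (s \ t).card then ((2 * r + 1 : ℕ) : ℂ) else 0) *
            ((∏ l ∈ t, f l x) * ∏ l ∈ s \ t, conj (f l x))) μ := fun s hs t ht =>
      (integrable_prod_mul_prod_conj hr hf (Finset.mem_powerset.mp ht)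
        (Finset.mem_powersetCard.mp hs).2).const_mul _
    rw [integral_finsetSum _ fun s hs => integrable_finsetSum _ (hint s hs)]
    refine Finset.sum_eq_zero fun s hs => ?_
    rw [integral_finsetSum _ (hint s hs)]
    refine Finset.sum_eq_zero fun t ht => ?_
    rw [integral_const_mul]
    split_ifs with hc
    · have hs' := (Finset.mem_powersetCard.mp hs).2
      have := Finset.card_sdiff_add_card_eq_card (Finset.mem_powerset.mp ht)
      rw [h.integral_prod_eq_zero Finset.disjoint_sdiff (by omega) (by omega), mul_zero]
    · rw [zero_mul]
  exact_mod_cast h1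

theorem memLp_ellNorm {q : ℕ} (hq : q ≠ 0) {p : ℝ≥0∞} (hf : ∀ l, MemLp (f l) p μ) :
    MemLp (ellNorm q f) p μ := by
  have h1 : MemLp (fun x => ∑ l, ‖f l x‖) p μ := memLp_finsetSum _ fun l _ => (hf l).norm
  refine h1.mono ?_ (Filter.Eventually.of_forall fun x => ?_)
  · have : AEMeasurable (ellNorm q f) μ := by
      unfold ellNorm
      refine AEMeasurable.pow_const ?_ _
      exact Finset.aemeasurable_fun_sum _ fun l _ =>
        ((hf l).aestronglyMeasurable.norm.aemeasurable).pow_const _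
    exact this.aestronglyMeasurable
  · rw [Real.norm_of_nonneg (ellNorm_nonneg q f x), Real.norm_of_nonneg (by positivity)]
    exact ellNorm_le_sum hq f x

theorem eLpNorm_natCast_pow_eq_ofReal_integral {E : Type*} [NormedAddCommGroup E] {g : X → E}
    {n : ℕ} (hn : n ≠ 0) (hg : MemLp g n μ) :
    eLpNorm g n μ ^ n = ENNReal.ofReal (∫ x, ‖g x‖ ^ n ∂μ) := by
  have h := eLpNorm_nnreal_pow_eq_lintegral (f := g) (μ := μ) (p := (n : ℝ≥0))
    (by exact_mod_cast hn)
  simp only [ENNReal.coe_natCast, NNReal.coe_natCast, ENNReal.rpow_natCast] at h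
  rw [h, ofReal_integral_eq_lintegral_ofReal (hg.integrable_norm_pow hn)
    (Filter.Eventually.of_forall fun x => by positivity)]
  refine lintegral_congr fun x => ?_
  rw [ENNReal.ofReal_pow (norm_nonneg _), ofReal_norm]

/-- The direct square function estimate: a superorthogonal sum is controlled by its square
function. -/
theorem exists_eLpNorm_sum_le_ellNorm (r : ℕ) (hr : r ≠ 0) : ∃ C : ℝ≥0,
    ∀ {X : Type*} [MeasurableSpace X] (μ : Measure X) {L : ℕ} (f : Fin L → X → ℂ),
      TypeIVSuperorthogonal μ r f → (∀ l, MemLp (f l) ((2 * r : ℕ) : ℝ≥0∞) μ) →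
      eLpNorm (fun x => ∑ l, f l x) ((2 * r : ℕ) : ℝ≥0∞) μ
        ≤ C * eLpNorm (ellNorm 2 f) ((2 * r : ℕ) : ℝ≥0∞) μ := by
  obtain ⟨a, C, hC, H⟩ := exists_norm_sum_pow_le r hr
  have hn : 2 * r ≠ 0 := by omega
  refine ⟨(C + 1).toNNReal, fun {X} _ μ {L} f h hf => ?_⟩
  have hsum : MemLp (fun x => ∑ l, f l x) ((2 * r : ℕ) : ℝ≥0∞) μ :=
    memLp_finsetSum _ fun l _ => hf l
  have hell := memLp_ellNorm (μ := μ) two_ne_zero hf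
  have hint := hell.integrable_norm_pow hn
  have h2 : ∀ x, ‖ellNorm 2 f x‖ ^ (2 * r) = (∑ l, ‖f l x‖ ^ 2) ^ r := fun x => by
    rw [Real.norm_of_nonneg (ellNorm_nonneg 2 f x), pow_mul, ellNorm_pow two_ne_zero]
  have h3 : ∫ x, ‖∑ l, f l x‖ ^ (2 * r) ∂μ ≤ C * ∫ x, ‖ellNorm 2 f x‖ ^ (2 * r) ∂μ := by
    calc ∫ x, ‖∑ l, f l x‖ ^ (2 * r) ∂μ
        ≤ ∫ x, a * rotSymm r (fun l => f l x) + C * ‖ellNorm 2 f x‖ ^ (2 * r) ∂μ := by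
          refine integral_mono (hsum.integrable_norm_pow hn)
            (((integrable_rotSymm hr hf).const_mul a).add (hint.const_mul C)) fun x => ?_
          simp only [h2]
          exact H _
      _ = _ := by
        rw [integral_add ((integrable_rotSymm hr hf).const_mul a) (hint.const_mul C),
          integral_const_mul, integral_const_mul, h.integral_rotSymm hr hf]
        ring
  rw [← ENNReal.pow_le_pow_left_iff hn, mul_pow, eLpNorm_natCast_pow_eq_ofReal_integral hn hsum,
    eLpNorm_natCast_pow_eq_ofReal_integral hn hell]
  calc _ ≤ ENNReal.ofReal (C * ∫ x, ‖ellNorm 2 f x‖ ^ (2 * r) ∂μ) := ENNReal.ofReal_le_ofReal h3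
    _ = ENNReal.ofReal C * ENNReal.ofReal (∫ x, ‖ellNorm 2 f x‖ ^ (2 * r) ∂μ) :=
      ENNReal.ofReal_mul hC
    _ ≤ _ := by
      gcongr
      change ENNReal.ofReal C ≤ (ENNReal.ofReal (C + 1)) ^ (2 * r)
      rw [← ENNReal.ofReal_pow (by positivity)]
      exact ENNReal.ofReal_le_ofReal ((by linarith : C ≤ C + 1).trans
        (le_self_pow₀ (by linarith) hn))

/-- The converse square function estimate: the square function of a superorthogonal family is
controlled by the sum and the `ℓ^{2r}` norm. -/
theorem exists_eLpNorm_ellNorm_le (r : ℕ) (hr : r ≠ 0) : ∃ C : ℝ≥0,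
    ∀ {X : Type*} [MeasurableSpace X] (μ : Measure X) {L : ℕ} (f : Fin L → X → ℂ),
      TypeIVSuperorthogonal μ r f → (∀ l, MemLp (f l) ((2 * r : ℕ) : ℝ≥0∞) μ) →
      eLpNorm (ellNorm 2 f) ((2 * r : ℕ) : ℝ≥0∞) μ
        ≤ C * (eLpNorm (fun x => ∑ l, f l x) ((2 * r : ℕ) : ℝ≥0∞) μ +
          eLpNorm (ellNorm (2 * r) f) ((2 * r : ℕ) : ℝ≥0∞) μ) := by
  obtain ⟨b, C, hC, H⟩ := exists_norm_square_pow_le r hr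
  have hn : 2 * r ≠ 0 := by omega
  refine ⟨(C + 1).toNNReal, fun {X} _ μ {L} f h hf => ?_⟩
  have hsum : MemLp (fun x => ∑ l, f l x) ((2 * r : ℕ) : ℝ≥0∞) μ :=
    memLp_finsetSum _ fun l _ => hf l
  have hell := memLp_ellNorm (μ := μ) two_ne_zero hf
  have hell' := memLp_ellNorm (μ := μ) hn hf
  have hint := hsum.integrable_norm_pow hn
  have hint' := hell'.integrable_norm_pow hn
  have h2 : ∀ x, ‖ellNorm 2 f x‖ ^ (2 * r) = (∑ l, ‖f l x‖ ^ 2) ^ r := fun x => by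
    rw [Real.norm_of_nonneg (ellNorm_nonneg 2 f x), pow_mul, ellNorm_pow two_ne_zero]
  have h2' : ∀ x, ‖ellNorm (2 * r) f x‖ ^ (2 * r) = ∑ l, ‖f l x‖ ^ (2 * r) := fun x => by
    rw [Real.norm_of_nonneg (ellNorm_nonneg _ f x), ellNorm_pow hn]
  have h3 : ∫ x, ‖ellNorm 2 f x‖ ^ (2 * r) ∂μ ≤ C * (∫ x, ‖∑ l, f l x‖ ^ (2 * r) ∂μ +
      ∫ x, ‖ellNorm (2 * r) f x‖ ^ (2 * r) ∂μ) := by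
    calc ∫ x, ‖ellNorm 2 f x‖ ^ (2 * r) ∂μ
        ≤ ∫ x, b * rotSymm r (fun l => f l x) +
            C * (‖∑ l, f l x‖ ^ (2 * r) + ‖ellNorm (2 * r) f x‖ ^ (2 * r)) ∂μ := by
          refine integral_mono (hell.integrable_norm_pow hn)
            (((integrable_rotSymm hr hf).const_mul b).add ((hint.add hint').const_mul C))
            fun x => ?_
          simp only [h2, h2']
          exact H _
      _ = _ := by
        rw [integral_add ((integrable_rotSymm hr hf).const_mul b)
          (by exact (hint.add hint').const_mul C),
          integral_const_mul, integral_const_mul, h.integral_rotSymm hr hf,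
          integral_add hint hint']
        ring
  have h0 : 0 ≤ ∫ x, ‖∑ l, f l x‖ ^ (2 * r) ∂μ := integral_nonneg fun x => by positivity
  have h0' : 0 ≤ ∫ x, ‖ellNorm (2 * r) f x‖ ^ (2 * r) ∂μ := integral_nonneg fun x => by positivity
  rw [← ENNReal.pow_le_pow_left_iff hn, mul_pow, eLpNorm_natCast_pow_eq_ofReal_integral hn hell]
  calc _ ≤ _ := ENNReal.ofReal_le_ofReal h3
    _ = ENNReal.ofReal C * (eLpNorm (fun x => ∑ l, f l x) ((2 * r : ℕ) : ℝ≥0∞) μ ^ (2 * r) +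
          eLpNorm (ellNorm (2 * r) f) ((2 * r : ℕ) : ℝ≥0∞) μ ^ (2 * r)) := by
      rw [ENNReal.ofReal_mul hC, ENNReal.ofReal_add h0 h0',
        eLpNorm_natCast_pow_eq_ofReal_integral hn hsum,
        eLpNorm_natCast_pow_eq_ofReal_integral hn hell']
    _ ≤ _ := by
      refine mul_le_mul' ?_ (pow_add_pow_le zero_le zero_le hn)
      change ENNReal.ofReal C ≤ (ENNReal.ofReal (C + 1)) ^ (2 * r)
      rw [← ENNReal.ofReal_pow (by positivity)]
      exact ENNReal.ofReal_le_ofReal ((by linarith : C ≤ C + 1).trans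
        (le_self_pow₀ (by linarith) hn))

end Integrals

/-! ### Khintchine's inequality for random signs -/

/-- The choice of signs that is `1` on `t` and `-1` off `t`. -/
noncomputable def signOn {ι : Type*} [DecidableEq ι] (t : Finset ι) (l : ι) : ℝ :=
  if l ∈ t then 1 else -1

section Khintchine

variable {ι : Type*} [DecidableEq ι]

/-- Splitting off one random sign. -/
theorem sum_signOn_insert (φ : ℂ → ℝ) (a : ι → ℂ) {s : Finset ι} {i : ι} (hi : i ∉ s) :
    ∑ t ∈ (insert i s).powerset, φ (∑ l ∈ insert i s, (signOn t l : ℂ) * a l) =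
      ∑ t ∈ s.powerset, (φ ((∑ l ∈ s, (signOn t l : ℂ) * a l) - a i) +
        φ ((∑ l ∈ s, (signOn t l : ℂ) * a l) + a i)) := by
  rw [Finset.sum_powerset_insert hi, Finset.sum_add_distrib]
  congr 1
  · refine Finset.sum_congr rfl fun t ht => ?_
    have hit : i ∉ t := fun h => hi (Finset.mem_powerset.mp ht h)
    rw [Finset.sum_insert hi, signOn, if_neg hit]
    congr 1
    push_cast
    ring
  · refine Finset.sum_congr rfl fun t ht => ?_
    rw [Finset.sum_insert hi, signOn, if_pos (Finset.mem_insert_self i t)]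
    have : ∀ l ∈ s, (signOn (insert i t) l : ℂ) * a l = (signOn t l : ℂ) * a l := by
      intro l hl
      have hli : l ≠ i := fun h => hi (h ▸ hl)
      simp [signOn, Finset.mem_insert, hli]
    rw [Finset.sum_congr rfl this]
    congr 1
    push_cast
    ring

theorem sum_norm_signOn_sq (a : ι → ℂ) (s : Finset ι) :
    ∑ t ∈ s.powerset, ‖∑ l ∈ s, (signOn t l : ℂ) * a l‖ ^ 2 =
      2 ^ s.card * ∑ l ∈ s, ‖a l‖ ^ 2 := by
  induction s using Finset.induction_on with
  | empty => simp
  | insert i s hi ih =>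
    rw [sum_signOn_insert (fun z => ‖z‖ ^ 2) a hi, Finset.card_insert_of_notMem hi,
      Finset.sum_insert hi]
    have h : ∀ z : ℂ, ‖z - a i‖ ^ 2 + ‖z + a i‖ ^ 2 = 2 * ‖z‖ ^ 2 + 2 * ‖a i‖ ^ 2 := by
      intro z
      have := parallelogram_law_with_norm ℝ z (a i)
      nlinarith
    simp only [h]
    rw [Finset.sum_add_distrib, ← Finset.mul_sum, ih]
    simp [Finset.card_powerset]
    ring

theorem sum_norm_signOn_four_le (a : ι → ℂ) (s : Finset ι) :
    ∑ t ∈ s.powerset, ‖∑ l ∈ s, (signOn t l : ℂ) * a l‖ ^ 4 ≤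
      3 * 2 ^ s.card * (∑ l ∈ s, ‖a l‖ ^ 2) ^ 2 := by
  induction s using Finset.induction_on with
  | empty => simp
  | insert i s hi ih =>
    rw [sum_signOn_insert (fun z => ‖z‖ ^ 4) a hi, Finset.card_insert_of_notMem hi,
      Finset.sum_insert hi]
    have h : ∀ z : ℂ, ‖z - a i‖ ^ 4 + ‖z + a i‖ ^ 4 ≤
        2 * ‖z‖ ^ 4 + 12 * ‖a i‖ ^ 2 * ‖z‖ ^ 2 + 2 * ‖a i‖ ^ 4 := by
      intro z
      have h1 := norm_add_sq_real z (a i)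
      have h2 := norm_sub_sq_real z (a i)
      have h3 := abs_real_inner_le_norm z (a i)
      have h4 : inner ℝ z (a i) ^ 2 ≤ (‖z‖ * ‖a i‖) ^ 2 := by
        rw [← sq_abs]; gcongr
      have h5 : ∀ w : ℂ, ‖w‖ ^ 4 = (‖w‖ ^ 2) ^ 2 := fun w => by ring
      rw [h5, h5, h1, h2]
      nlinarith
    refine (Finset.sum_le_sum fun t _ => h _).trans ?_
    rw [Finset.sum_add_distrib, Finset.sum_add_distrib, ← Finset.mul_sum, ← Finset.mul_sum,
      sum_norm_signOn_sq]
    simp only [Finset.sum_const, Finset.card_powerset, nsmul_eq_mul]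
    push_cast
    have h6 : (0 : ℝ) ≤ 2 ^ s.card * ‖a i‖ ^ 4 := by positivity
    have h7 : 3 * 2 ^ (s.card + 1) * (‖a i‖ ^ 2 + ∑ l ∈ s, ‖a l‖ ^ 2) ^ 2 =
        2 * (3 * 2 ^ s.card * (∑ l ∈ s, ‖a l‖ ^ 2) ^ 2) +
        12 * ‖a i‖ ^ 2 * (2 ^ s.card * ∑ l ∈ s, ‖a l‖ ^ 2) +
        6 * (2 ^ s.card * ‖a i‖ ^ 4) := by ring
    linarith

/-- Khintchine's inequality, with the first absolute moment: it follows from the second moment and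
from the bound for the fourth moment. -/
theorem sqrt_sum_sq_le_sum_signOn [Fintype ι] (a : ι → ℂ) :
    2 ^ Fintype.card ι * √(∑ l, ‖a l‖ ^ 2) ≤
      6 * ∑ t : Finset ι, ‖∑ l, (signOn t l : ℂ) * a l‖ := by
  have h2 := sum_norm_signOn_sq a Finset.univ
  have h4 := sum_norm_signOn_four_le a Finset.univ
  simp only [Finset.powerset_univ, Finset.card_univ] at h2 h4
  have hS : 0 ≤ ∑ l, ‖a l‖ ^ 2 := Finset.sum_nonneg fun l _ => by positivity
  generalize hσ : √(∑ l, ‖a l‖ ^ 2) = σ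
  have hσ0 : 0 ≤ σ := hσ ▸ Real.sqrt_nonneg _
  have hσ2 : ∑ l, ‖a l‖ ^ 2 = σ ^ 2 := by rw [← hσ, Real.sq_sqrt hS]
  rw [hσ2] at h2 h4
  have hsum : 0 ≤ ∑ t : Finset ι, ‖∑ l, (signOn t l : ℂ) * a l‖ :=
    Finset.sum_nonneg fun t _ => norm_nonneg _
  -- a pointwise substitute for Hölder's inequality between the moments of order 1, 2 and 4
  have key : ∀ y : ℝ, 0 ≤ y → σ ^ 2 * y ^ 2 ≤ 3 * σ ^ 3 * y + y ^ 4 / 6 := by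
    intro y hy
    rcases le_total y (3 * σ) with h | h
    · have : σ ^ 2 * y * y ≤ σ ^ 2 * y * (3 * σ) := by gcongr
      have : 0 ≤ y ^ 4 / 6 := by positivity
      nlinarith
    · have h1 : (3 * σ) ^ 2 ≤ y ^ 2 := by gcongr
      have h3 : 0 ≤ 3 * σ ^ 3 * y := by positivity
      have h5 : (3 * σ) ^ 2 * y ^ 2 ≤ y ^ 2 * y ^ 2 := by gcongr
      nlinarith [sq_nonneg (σ * y)]
  have h := Finset.sum_le_sum fun (t : Finset ι) (_ : t ∈ Finset.univ) =>
    key ‖∑ l, (signOn t l : ℂ) * a l‖ (norm_nonneg _)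
  rw [← Finset.mul_sum, Finset.sum_add_distrib, ← Finset.mul_sum, ← Finset.sum_div, h2] at h
  rcases hσ0.eq_or_lt with h0 | h0
  · rw [← h0, mul_zero]; positivity
  · refine le_of_mul_le_mul_left (a := σ ^ 3) ?_ (by positivity)
    nlinarith

end Khintchine

theorem ellNorm_two {X : Type*} {L : ℕ} (f : Fin L → X → ℂ) (x : X) :
    ellNorm 2 f x = √(∑ l, ‖f l x‖ ^ 2) := by
  rw [ellNorm, Real.sqrt_eq_rpow]; norm_num

/-- Khintchine's inequality in `L^p`: the square function is controlled by any uniform bound for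
the sums with signs. -/
theorem eLpNorm_ellNorm_two_le_of_signOn {X : Type*} [MeasurableSpace X] {μ : Measure X} {L : ℕ}
    {p : ℝ≥0∞} (hp : 1 ≤ p) {f : Fin L → X → ℂ} (hf : ∀ l, AEStronglyMeasurable (f l) μ)
    {K : ℝ≥0∞}
    (hK : ∀ t : Finset (Fin L), eLpNorm (fun x => ∑ l, (signOn t l : ℂ) * f l x) p μ ≤ K) :
    eLpNorm (ellNorm 2 f) p μ ≤ 6 * K := by
  have hm : ∀ t : Finset (Fin L),
      AEStronglyMeasurable (fun x => ∑ l, (signOn t l : ℂ) * f l x) μ := fun t =>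
    Finset.aestronglyMeasurable_fun_sum _ fun l _ => (hf l).const_mul _
  have h1 : eLpNorm (ellNorm 2 f) p μ ≤
      eLpNorm ((6 / 2 ^ L : ℝ) • fun x => ∑ t : Finset (Fin L),
        ‖∑ l, (signOn t l : ℂ) * f l x‖) p μ := by
    refine eLpNorm_mono_real fun x => ?_
    have h := sqrt_sum_sq_le_sum_signOn (fun l => f l x)
    rw [Fintype.card_fin] at h
    rw [Real.norm_of_nonneg (ellNorm_nonneg 2 f x), ellNorm_two, Pi.smul_apply, smul_eq_mul,
      div_mul_eq_mul_div, le_div_iff₀ (by positivity)]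
    linarith
  refine h1.trans ((eLpNorm_const_smul_le).trans ?_)
  have h2 : eLpNorm (fun x => ∑ t : Finset (Fin L), ‖∑ l, (signOn t l : ℂ) * f l x‖) p μ ≤
      2 ^ L * K := by
    have h3 := eLpNorm_sum_le (s := (Finset.univ : Finset (Finset (Fin L)))) (μ := μ)
      (f := fun t x => ‖∑ l, (signOn t l : ℂ) * f l x‖) (fun t _ => (hm t).norm) hp
    have h4 : (∑ t : Finset (Fin L), fun x => ‖∑ l, (signOn t l : ℂ) * f l x‖) =
        fun x => ∑ t : Finset (Fin L), ‖∑ l, (signOn t l : ℂ) * f l x‖ := by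
      ext x; simp
    rw [h4] at h3
    refine h3.trans ?_
    refine (Finset.sum_le_card_nsmul _ _ K fun t _ => ?_).trans ?_
    · rw [eLpNorm_norm]; exact hK t
    · simp
  refine (mul_le_mul_right h2 _).trans ?_
  rw [← mul_assoc]
  gcongr
  have h5 : ‖(6 / 2 ^ L : ℝ)‖ₑ = 6 / 2 ^ L := by
    rw [Real.enorm_of_nonneg (by positivity), ENNReal.ofReal_div_of_pos (by positivity)]
    simp [ENNReal.ofReal_pow]
  rw [h5, ENNReal.div_mul_cancel (by simp) (by simp)]

/-! ### Interpolation between `L^2` and `L^q` -/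

section Interpolation

variable {X : Type*} [MeasurableSpace X] {μ : Measure X}

/-- Chebyshev's inequality, with the weight of the layer cake formula for the `p`-th power. -/
theorem meas_half_lt_norm_mul_le {h : X → ℂ} (hh : AEMeasurable h μ) {s : ℝ} (hs : 0 < s) (p : ℝ)
    {t : ℝ} (ht : 0 < t) :
    μ {x | t / 2 < ‖h x‖} * ENNReal.ofReal (t ^ (p - 1)) ≤
      (∫⁻ x, ‖h x‖ₑ ^ s ∂μ) * ENNReal.ofReal (2 ^ s * t ^ (p - 1 - s)) := by
  have h1 : {x | t / 2 < ‖h x‖} ⊆ {x | ENNReal.ofReal ((t / 2) ^ s) ≤ ‖h x‖ₑ ^ s} := by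
    intro x hx
    simp only [Set.mem_ofPred_eq] at hx ⊢
    rw [← ofReal_norm, ENNReal.ofReal_rpow_of_nonneg (norm_nonneg _) hs.le]
    exact ENNReal.ofReal_le_ofReal (Real.rpow_le_rpow (by positivity) hx.le hs.le)
  have h2 := mul_meas_ge_le_lintegral₀ (hh.enorm.pow_const s)
    (ENNReal.ofReal ((t / 2) ^ s))
  have h3 : ENNReal.ofReal (t ^ (p - 1)) =
      ENNReal.ofReal ((t / 2) ^ s) * ENNReal.ofReal (2 ^ s * t ^ (p - 1 - s)) := by
    rw [← ENNReal.ofReal_mul (by positivity), Real.rpow_sub ht (p - 1) s,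
      Real.div_rpow ht.le zero_le_two]
    congr 1
    field_simp
  calc _ ≤ μ {x | ENNReal.ofReal ((t / 2) ^ s) ≤ ‖h x‖ₑ ^ s} * ENNReal.ofReal (t ^ (p - 1)) := by
        gcongr
    _ = (ENNReal.ofReal ((t / 2) ^ s) * μ {x | ENNReal.ofReal ((t / 2) ^ s) ≤ ‖h x‖ₑ ^ s}) *
        ENNReal.ofReal (2 ^ s * t ^ (p - 1 - s)) := by
      rw [h3]; ring
    _ ≤ _ := by gcongr

theorem setLIntegral_Ioo_rpow {a b : ℝ} (ha : 0 ≤ a) (hb : -1 < b) :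
    ∫⁻ t in Set.Ioo 0 a, ENNReal.ofReal (t ^ b) = ENNReal.ofReal (a ^ (b + 1) / (b + 1)) := by
  rw [setLIntegral_congr Ioo_ae_eq_Ioc, ← ofReal_integral_eq_lintegral_ofReal,
    ← intervalIntegral.integral_of_le ha, integral_rpow (Or.inl hb), Real.zero_rpow (by linarith),
    sub_zero]
  · exact (intervalIntegrable_iff_integrableOn_Ioc_of_le ha).mp
      (intervalIntegral.intervalIntegrable_rpow' hb)
  · exact (ae_restrict_iff' measurableSet_Ioc).mpr
      (Filter.Eventually.of_forall fun t ht => Real.rpow_nonneg ht.1.le _)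

theorem setLIntegral_Ici_rpow {a b : ℝ} (ha : 0 < a) (hb : b < -1) :
    ∫⁻ t in Set.Ici a, ENNReal.ofReal (t ^ b) = ENNReal.ofReal (a ^ (b + 1) / -(b + 1)) := by
  rw [setLIntegral_congr Ioi_ae_eq_Ici.symm, ← ofReal_integral_eq_lintegral_ofReal,
    integral_Ioi_rpow_of_lt hb ha, neg_div, div_neg]
  · exact integrableOn_Ioi_rpow_of_lt hb ha
  · exact (ae_restrict_iff' measurableSet_Ioi).mpr
      (Filter.Eventually.of_forall fun t ht => Real.rpow_nonneg (ha.trans ht).le _)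

/-- The contribution of the large values of `f` to the layer cake formula. -/
theorem lintegral_large_part_le [SFinite μ] {f : X → ℂ} (hf : Measurable f) {s p : ℝ} (hs : 0 < s)
    (hsp : s < p) :
    ∫⁻ t in Set.Ioi 0, (∫⁻ x, {x | t < ‖f x‖}.indicator (fun x => ‖f x‖ₑ ^ s) x ∂μ) *
        ENNReal.ofReal (2 ^ s * t ^ (p - 1 - s)) ≤
      ENNReal.ofReal (2 ^ s / (p - s)) * ∫⁻ x, ‖f x‖ₑ ^ p ∂μ := by
  have hm : Measurable fun z : ℝ × X => (if z.1 < ‖f z.2‖ then ‖f z.2‖ₑ ^ s else 0) *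
      ENNReal.ofReal (2 ^ s * z.1 ^ (p - 1 - s)) := by
    refine Measurable.mul (Measurable.ite (measurableSet_lt measurable_fst
      (hf.comp measurable_snd).norm) (((hf.comp measurable_snd).enorm).pow_const s)
      measurable_const) (by fun_prop)
  have h1 : ∀ t : ℝ, (∫⁻ x, {x | t < ‖f x‖}.indicator (fun x => ‖f x‖ₑ ^ s) x ∂μ) *
      ENNReal.ofReal (2 ^ s * t ^ (p - 1 - s)) =
      ∫⁻ x, (if t < ‖f x‖ then ‖f x‖ₑ ^ s else 0) *
        ENNReal.ofReal (2 ^ s * t ^ (p - 1 - s)) ∂μ := by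
    intro t
    rw [← lintegral_mul_const' _ _ ENNReal.ofReal_ne_top]
    rfl
  simp only [h1]
  rw [lintegral_lintegral_swap hm.aemeasurable, ← lintegral_const_mul' _ _ ENNReal.ofReal_ne_top]
  refine lintegral_mono fun x => ?_
  have h2 : ∀ t : ℝ, (if t < ‖f x‖ then ‖f x‖ₑ ^ s else 0) *
      ENNReal.ofReal (2 ^ s * t ^ (p - 1 - s)) =
      (ENNReal.ofReal (2 ^ s) * ‖f x‖ₑ ^ s) *
        (Set.Iio ‖f x‖).indicator (fun t => ENNReal.ofReal (t ^ (p - 1 - s))) t := by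
    intro t
    rw [ENNReal.ofReal_mul (by positivity)]
    simp only [Set.indicator, Set.mem_Iio]
    split_ifs
    · ring
    · simp
  simp only [h2]
  rw [lintegral_const_mul' _ _ (ENNReal.mul_ne_top ENNReal.ofReal_ne_top
      (ENNReal.rpow_ne_top_of_nonneg hs.le enorm_ne_top)),
    lintegral_indicator measurableSet_Iio, Measure.restrict_restrict measurableSet_Iio,
    Set.inter_comm, Set.Ioi_inter_Iio, setLIntegral_Ioo_rpow (norm_nonneg _) (by linarith),
    ← ofReal_norm, ENNReal.ofReal_rpow_of_nonneg (norm_nonneg _) hs.le,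
    ENNReal.ofReal_rpow_of_nonneg (norm_nonneg _) (hs.trans hsp).le,
    ← ENNReal.ofReal_mul (by positivity), ← ENNReal.ofReal_mul (by positivity),
    ← ENNReal.ofReal_mul (div_nonneg (by positivity) (by linarith))]
  refine ENNReal.ofReal_le_ofReal (le_of_eq ?_)
  have h3 : ‖f x‖ ^ p = ‖f x‖ ^ s * ‖f x‖ ^ (p - s) := by
    rw [← Real.rpow_add_of_nonneg (norm_nonneg _) hs.le (by linarith)]
    congr 1; ring
  rw [h3, show p - 1 - s + 1 = p - s by ring]
  ring

/-- The contribution of the small values of `f` to the layer cake formula. -/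
theorem lintegral_small_part_le [SFinite μ] {f : X → ℂ} (hf : Measurable f) {s p : ℝ} (hp : 0 < p)
    (hsp : p < s) :
    ∫⁻ t in Set.Ioi 0, (∫⁻ x, {x | t < ‖f x‖}ᶜ.indicator (fun x => ‖f x‖ₑ ^ s) x ∂μ) *
        ENNReal.ofReal (2 ^ s * t ^ (p - 1 - s)) ≤
      ENNReal.ofReal (2 ^ s / (s - p)) * ∫⁻ x, ‖f x‖ₑ ^ p ∂μ := by
  have hs : 0 < s := hp.trans hsp
  have hm : Measurable fun z : ℝ × X => (if z.1 < ‖f z.2‖ then 0 else ‖f z.2‖ₑ ^ s) *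
      ENNReal.ofReal (2 ^ s * z.1 ^ (p - 1 - s)) := by
    refine Measurable.mul (Measurable.ite (measurableSet_lt measurable_fst
      (hf.comp measurable_snd).norm) measurable_const
      (((hf.comp measurable_snd).enorm).pow_const s)) (by fun_prop)
  have h1 : ∀ t : ℝ, (∫⁻ x, {x | t < ‖f x‖}ᶜ.indicator (fun x => ‖f x‖ₑ ^ s) x ∂μ) *
      ENNReal.ofReal (2 ^ s * t ^ (p - 1 - s)) =
      ∫⁻ x, (if t < ‖f x‖ then 0 else ‖f x‖ₑ ^ s) *
        ENNReal.ofReal (2 ^ s * t ^ (p - 1 - s)) ∂μ := by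
    intro t
    rw [← lintegral_mul_const' _ _ ENNReal.ofReal_ne_top]
    refine lintegral_congr fun x => ?_
    by_cases hx : t < ‖f x‖ <;> simp [Set.indicator, hx]
  simp only [h1]
  rw [lintegral_lintegral_swap hm.aemeasurable, ← lintegral_const_mul' _ _ ENNReal.ofReal_ne_top]
  refine lintegral_mono fun x => ?_
  rcases (norm_nonneg (f x)).eq_or_lt with h0 | h0
  · have hx : f x = 0 := norm_eq_zero.mp h0.symm
    simp [hx, hs]
  have h2 : ∀ t : ℝ, (if t < ‖f x‖ then 0 else ‖f x‖ₑ ^ s) *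
      ENNReal.ofReal (2 ^ s * t ^ (p - 1 - s)) =
      (ENNReal.ofReal (2 ^ s) * ‖f x‖ₑ ^ s) *
        (Set.Ici ‖f x‖).indicator (fun t => ENNReal.ofReal (t ^ (p - 1 - s))) t := by
    intro t
    rw [ENNReal.ofReal_mul (by positivity)]
    simp only [Set.indicator, Set.mem_Ici, ← not_lt (a := t)]
    split_ifs
    · simp
    · ring
  simp only [h2]
  rw [lintegral_const_mul' _ _ (ENNReal.mul_ne_top ENNReal.ofReal_ne_top
      (ENNReal.rpow_ne_top_of_nonneg hs.le enorm_ne_top)),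
    lintegral_indicator measurableSet_Ici, Measure.restrict_restrict measurableSet_Ici,
    Set.inter_eq_left.mpr (Set.Ici_subset_Ioi.mpr h0),
    setLIntegral_Ici_rpow h0 (by linarith),
    ← ofReal_norm, ENNReal.ofReal_rpow_of_nonneg (norm_nonneg _) hs.le,
    ENNReal.ofReal_rpow_of_nonneg (norm_nonneg _) hp.le,
    ← ENNReal.ofReal_mul (by positivity), ← ENNReal.ofReal_mul (by positivity),
    ← ENNReal.ofReal_mul (div_nonneg (by positivity) (by linarith))]
  refine ENNReal.ofReal_le_ofReal (le_of_eq ?_)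
  have h3 : ‖f x‖ ^ p = ‖f x‖ ^ s * ‖f x‖ ^ (p - s) := by
    rw [← Real.rpow_add h0]
    congr 1; ring
  rw [h3, show p - 1 - s + 1 = p - s by ring, show -(p - s) = s - p by ring]
  ring

theorem memLp_restrict {f : SimpleFunc X ℂ} {q : ℝ≥0∞} (hf : MemLp f q μ) {A : Set X}
    (hA : MeasurableSet A) : MemLp (f.restrict A) q μ := by
  rw [SimpleFunc.coe_restrict f hA]
  exact hf.indicator hA

theorem lintegral_enorm_restrict_rpow {f : SimpleFunc X ℂ} {s : ℝ} (hs : 0 < s) {A : Set X}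
    (hA : MeasurableSet A) :
    ∫⁻ x, ‖f.restrict A x‖ₑ ^ s ∂μ = ∫⁻ x, A.indicator (fun x => ‖f x‖ₑ ^ s) x ∂μ := by
  refine lintegral_congr fun x => ?_
  rw [SimpleFunc.restrict_apply f hA]
  by_cases hx : x ∈ A <;> simp [hx, hs]

/-- The Marcinkiewicz interpolation theorem for linear operators between `L^2` and `L^q`, tested on
simple functions, which are stable under truncation. -/
theorem marcinkiewicz_simpleFunc [SFinite μ] (D : Lp ℂ 2 μ →L[ℂ] Lp ℂ 2 μ) {p q : ℝ} (hp : 2 < p)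
    (hpq : p < q) {C₂ C : ℝ≥0}
    (h2 : ∀ (f : SimpleFunc X ℂ) (hf : MemLp f 2 μ),
      ∫⁻ x, ‖D (hf.toLp f) x‖ₑ ^ (2 : ℝ) ∂μ ≤ C₂ * ∫⁻ x, ‖f x‖ₑ ^ (2 : ℝ) ∂μ)
    (hq : ∀ (f : SimpleFunc X ℂ) (hf : MemLp f 2 μ),
      ∫⁻ x, ‖D (hf.toLp f) x‖ₑ ^ q ∂μ ≤ C * ∫⁻ x, ‖f x‖ₑ ^ q ∂μ)
    (f : SimpleFunc X ℂ) (hf : MemLp f 2 μ) :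
    ∫⁻ x, ‖D (hf.toLp f) x‖ₑ ^ p ∂μ ≤
      ENNReal.ofReal p * (C₂ * ENNReal.ofReal (2 ^ (2 : ℝ) / (p - 2)) +
        C * ENNReal.ofReal (2 ^ q / (q - p))) * ∫⁻ x, ‖f x‖ₑ ^ p ∂μ := by
  have hmeas : ∀ g : Lp ℂ 2 μ, AEMeasurable g μ := fun g => (Lp.aestronglyMeasurable g).aemeasurable
  have hp0 : 0 < p := by linarith
  have hq0 : 0 < q := by linarith
  have h1 : ∫⁻ x, ‖D (hf.toLp f) x‖ₑ ^ p ∂μ =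
      ENNReal.ofReal p * ∫⁻ t in Set.Ioi 0,
        μ {x | t < ‖D (hf.toLp f) x‖} * ENNReal.ofReal (t ^ (p - 1)) := by
    rw [← lintegral_rpow_eq_lintegral_meas_lt_mul μ (Filter.Eventually.of_forall fun x =>
      norm_nonneg _) (hmeas _).norm hp0]
    refine lintegral_congr fun x => ?_
    rw [← ofReal_norm, ENNReal.ofReal_rpow_of_nonneg (norm_nonneg _) hp0.le]
  -- the distribution function of `D f` is estimated by cutting `f` at its own height `t`
  have h3 : ∀ t ∈ Set.Ioi (0 : ℝ),
      μ {x | t < ‖D (hf.toLp f) x‖} * ENNReal.ofReal (t ^ (p - 1)) ≤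
      C₂ * ((∫⁻ x, {x | t < ‖f x‖}.indicator (fun x => ‖f x‖ₑ ^ (2 : ℝ)) x ∂μ) *
        ENNReal.ofReal (2 ^ (2 : ℝ) * t ^ (p - 1 - 2))) +
      C * ((∫⁻ x, {x | t < ‖f x‖}ᶜ.indicator (fun x => ‖f x‖ₑ ^ q) x ∂μ) *
        ENNReal.ofReal (2 ^ q * t ^ (p - 1 - q))) := by
    intro t ht
    have hA : MeasurableSet {x | t < ‖f x‖} := measurableSet_lt measurable_const f.measurable.norm
    generalize {x | t < ‖f x‖} = A at hA
    have hf1 := memLp_restrict hf hA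
    have hf2 := memLp_restrict hf hA.compl
    have hsplit : hf.toLp f = hf1.toLp _ + hf2.toLp _ := by
      rw [← MemLp.toLp_add]
      refine MemLp.toLp_congr _ _ (Filter.Eventually.of_forall fun x => ?_)
      rw [Pi.add_apply, SimpleFunc.restrict_apply f hA, SimpleFunc.restrict_apply f hA.compl]
      exact (congrFun (Set.indicator_self_add_compl A f) x).symm
    have hsub : μ {x | t < ‖D (hf.toLp f) x‖} ≤
        μ {x | t / 2 < ‖D (hf1.toLp _) x‖} + μ {x | t / 2 < ‖D (hf2.toLp _) x‖} := by
      refine le_trans (measure_mono_ae ?_) (measure_union_le _ _)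
      have hadd := Lp.coeFn_add (D (hf1.toLp _)) (D (hf2.toLp _))
      rw [← map_add, ← hsplit] at hadd
      filter_upwards [hadd] with x hx hxt
      change t / 2 < _ ∨ t / 2 < _
      change t < ‖D (hf.toLp f) x‖ at hxt
      rw [hx, Pi.add_apply] at hxt
      by_contra! hcon
      have := norm_add_le (D (hf1.toLp _) x) (D (hf2.toLp _) x)
      linarith [hcon.1, hcon.2]
    refine (mul_le_mul_left hsub _).trans ?_
    rw [add_mul]
    refine add_le_add ?_ ?_
    · refine (meas_half_lt_norm_mul_le (hmeas _) two_pos p ht).trans ?_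
      rw [← mul_assoc, ← lintegral_enorm_restrict_rpow two_pos hA]
      gcongr
      exact h2 _ hf1
    · refine (meas_half_lt_norm_mul_le (hmeas _) hq0 p ht).trans ?_
      rw [← mul_assoc, ← lintegral_enorm_restrict_rpow hq0 hA.compl]
      gcongr
      exact hq _ hf2
  rw [h1, mul_assoc]
  gcongr
  refine (setLIntegral_mono' measurableSet_Ioi h3).trans ?_
  have hm : Measurable fun t : ℝ =>
      C₂ * ((∫⁻ x, {x | t < ‖f x‖}.indicator (fun x => ‖f x‖ₑ ^ (2 : ℝ)) x ∂μ) *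
        ENNReal.ofReal (2 ^ (2 : ℝ) * t ^ (p - 1 - 2))) := by
    refine Measurable.const_mul (Measurable.mul ?_ (by fun_prop)) _
    refine Measurable.lintegral_prod_right
      (f := fun t x => if t < ‖f x‖ then ‖f x‖ₑ ^ (2 : ℝ) else 0) ?_
    exact Measurable.ite (measurableSet_lt measurable_fst (f.measurable.comp measurable_snd).norm)
      (((f.measurable.comp measurable_snd).enorm).pow_const _) measurable_const
  rw [lintegral_add_left hm, lintegral_const_mul' _ _ ENNReal.coe_ne_top,
    lintegral_const_mul' _ _ ENNReal.coe_ne_top, add_mul, mul_assoc, mul_assoc]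
  gcongr
  · exact lintegral_large_part_le f.measurable two_pos hp
  · exact lintegral_small_part_le f.measurable hp0 hpq

end Interpolation

/-! ### Duality between `L^p` and `L^q` -/

/-- The norming function `|h|^{P - 2} h` of a function `h`. -/
noncomputable def normingFun {X : Type*} (P : ℝ) (h : X → ℂ) (x : X) : ℂ :=
  ((‖h x‖ ^ (P - 2) : ℝ) : ℂ) * h x

theorem conj_normingFun_mul {P : ℝ} (hP : 0 < P) {X : Type*} (h : X → ℂ) (x : X) :
    conj (normingFun P h x) * h x = ((‖h x‖ ^ P : ℝ) : ℂ) := by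
  rcases eq_or_ne (h x) 0 with h0 | h0
  · simp [h0, Real.zero_rpow hP.ne']
  · have h1 : 0 < ‖h x‖ := norm_pos_iff.mpr h0
    rw [normingFun, map_mul, Complex.conj_ofReal, mul_assoc, Complex.conj_mul',
      ← Complex.ofReal_pow, ← Complex.ofReal_mul, Real.rpow_sub h1, Real.rpow_two,
      div_mul_cancel₀ _ (by positivity)]

theorem enorm_normingFun {P : ℝ} (hP : 1 < P) {X : Type*} (h : X → ℂ) (x : X) :
    ‖normingFun P h x‖ₑ = ‖h x‖ₑ ^ (P - 1) := by
  rcases eq_or_ne (h x) 0 with h0 | h0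
  · simp [normingFun, h0, sub_pos.mpr hP]
  · have h1 : 0 < ‖h x‖ := norm_pos_iff.mpr h0
    rw [← ofReal_norm, ← ofReal_norm, ENNReal.ofReal_rpow_of_nonneg h1.le (by linarith),
      normingFun, norm_mul, Complex.norm_real, Real.norm_of_nonneg (by positivity)]
    congr 1
    nth_rewrite 2 [← Real.rpow_one ‖h x‖]
    rw [← Real.rpow_add h1]
    congr 1; ring

section Duality

variable {X : Type*} [MeasurableSpace X] {μ : Measure X} {p q : ℝ≥0∞}

theorem memLp_simpleFunc {f : SimpleFunc X ℂ} (hf : MemLp f 2 μ) (p : ℝ≥0∞) : MemLp f p μ :=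
  SimpleFunc.memLp_of_finite_measure_preimage p
    ((SimpleFunc.memLp_iff two_ne_zero ENNReal.ofNat_ne_top).mp hf)

theorem memLp_two_simpleFunc {f : SimpleFunc X ℂ} (hp0 : p ≠ 0) (hp : p ≠ ∞) (hf : MemLp f p μ) :
    MemLp f 2 μ :=
  SimpleFunc.memLp_of_finite_measure_preimage 2 ((SimpleFunc.memLp_iff hp0 hp).mp hf)

theorem lintegral_enorm_mul_le {𝕜 : Type*} [RCLike 𝕜] [p.HolderConjugate q] {f g : X → 𝕜}
    (hf : AEStronglyMeasurable f μ) (hg : AEStronglyMeasurable g μ) :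
    ∫⁻ x, ‖f x‖ₑ * ‖g x‖ₑ ∂μ ≤ eLpNorm f p μ * eLpNorm g q μ := by
  have h := eLpNorm_smul_le_mul_eLpNorm (p := p) (q := q) (r := 1) hg hf
  rw [eLpNorm_one_eq_lintegral_enorm] at h
  simpa [enorm_mul] using h

theorem enorm_integral_conj_mul_le [p.HolderConjugate q] {f g : X → ℂ}
    (hf : AEStronglyMeasurable f μ) (hg : AEStronglyMeasurable g μ) :
    ‖∫ x, conj (f x) * g x ∂μ‖ₑ ≤ eLpNorm f p μ * eLpNorm g q μ := by
  refine (enorm_integral_le_lintegral_enorm _).trans ?_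
  refine le_trans (le_of_eq (lintegral_congr fun x => ?_)) (lintegral_enorm_mul_le hf hg)
  rw [enorm_mul, RCLike.enorm_conj]

theorem eLpNorm_le_mul_iff (hp0 : p ≠ 0) (hp : p ≠ ∞) {Y E F : Type*} [MeasurableSpace Y]
    {ν : Measure Y} [NormedAddCommGroup E] [NormedAddCommGroup F] {f : X → E} {g : Y → F}
    {C : ℝ≥0∞} :
    eLpNorm f p μ ≤ C * eLpNorm g p ν ↔
      ∫⁻ x, ‖f x‖ₑ ^ p.toReal ∂μ ≤ C ^ p.toReal * ∫⁻ x, ‖g x‖ₑ ^ p.toReal ∂ν := by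
  have hp' : 0 < p.toReal := ENNReal.toReal_pos hp0 hp
  rw [eLpNorm_eq_lintegral_rpow_enorm_toReal hp0 hp, eLpNorm_eq_lintegral_rpow_enorm_toReal hp0 hp,
    one_div, ENNReal.rpow_inv_le_iff hp', ENNReal.mul_rpow_of_nonneg _ _ hp'.le,
    ENNReal.rpow_inv_rpow hp'.ne']

/-- A bound for the pairing of `h` with simple functions extends to `L^q` functions `G`. -/
theorem enorm_integral_conj_mul_le_of_forall_simpleFunc [p.HolderConjugate q] (hq : q ≠ ∞)
    {h G : X → ℂ} (hh : MemLp h p μ) (hG : MemLp G q μ) {K : ℝ≥0∞}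
    (hK : ∀ g : SimpleFunc X ℂ, MemLp g 2 μ →
      ‖∫ x, conj (g x) * h x ∂μ‖ₑ ≤ K * eLpNorm g q μ) {ε : ℝ≥0∞} (hε : ε ≠ 0) :
    ‖∫ x, conj (G x) * h x ∂μ‖ₑ ≤ K * (eLpNorm G q μ + ε) + ε * eLpNorm h p μ := by
  have hq0 : q ≠ 0 := ENNReal.HolderConjugate.ne_zero q p
  obtain ⟨g, hgε, hg⟩ := hG.exists_simpleFunc_eLpNorm_sub_lt hq hε
  have hone : ∀ {u : X → ℂ}, MemLp u q μ → Integrable (fun x => conj (u x) * h x) μ := by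
    intro u hu
    exact memLp_one_iff_integrable.mp (hh.mul' hu.star)
  have hsub : ∫ x, conj (G x) * h x ∂μ =
      ∫ x, conj (g x) * h x ∂μ + ∫ x, conj ((G - ⇑g) x) * h x ∂μ := by
    rw [← integral_add (hone hg) (hone (hG.sub hg))]
    refine integral_congr_ae (Filter.Eventually.of_forall fun x => ?_)
    simp only [Pi.sub_apply, map_sub]
    ring
  rw [hsub]
  refine (enorm_add_le _ _).trans (add_le_add ?_ ?_)
  · refine (hK g (memLp_two_simpleFunc hq0 hq hg)).trans ?_
    gcongr
    calc eLpNorm g q μ = eLpNorm (G - (G - ⇑g)) q μ := by rw [sub_sub_cancel]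
      _ ≤ _ := eLpNorm_sub_le hG.1 (hG.sub hg).1 (ENNReal.HolderConjugate.one_le q p)
      _ ≤ _ := by gcongr
  · have := enorm_integral_conj_mul_le (p := q) (q := p) (hG.sub hg).1 hh.1
    exact this.trans (by gcongr)

/-- The norm of an `L^p` function is determined by its pairings with simple functions in the dual
space. -/
theorem eLpNorm_le_of_forall_simpleFunc [p.HolderConjugate q] (hp : p ≠ ∞) (hq : q ≠ ∞)
    {h : X → ℂ} (hh : MemLp h p μ) {K : ℝ≥0∞}
    (hK : ∀ g : SimpleFunc X ℂ, MemLp g 2 μ →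
      ‖∫ x, conj (g x) * h x ∂μ‖ₑ ≤ K * eLpNorm g q μ) :
    eLpNorm h p μ ≤ K := by
  rcases eq_or_ne K ∞ with rfl | hKtop
  · exact le_top
  have hp0 : p ≠ 0 := ENNReal.HolderConjugate.ne_zero p q
  have hq0 : q ≠ 0 := ENNReal.HolderConjugate.ne_zero q p
  have hPQ : p.toReal.HolderConjugate q.toReal :=
    ENNReal.HolderConjugate.toReal_of_ne_top hp hq
  have hP1 : 1 < p.toReal := hPQ.lt
  have hG : AEStronglyMeasurable (normingFun p.toReal h) μ :=
    (Complex.measurable_ofReal.comp_aemeasurable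
      (hh.1.norm.aemeasurable.pow_const _)).aestronglyMeasurable.mul hh.1
  have hI : ∫⁻ x, ‖h x‖ₑ ^ p.toReal ∂μ ≠ ∞ :=
    (lintegral_rpow_enorm_lt_top_of_eLpNorm_lt_top hp0 hp hh.2).ne
  have hGq : eLpNorm (normingFun p.toReal h) q μ =
      (∫⁻ x, ‖h x‖ₑ ^ p.toReal ∂μ) ^ (1 / q.toReal) := by
    rw [eLpNorm_eq_lintegral_rpow_enorm_toReal hq0 hq]
    congr 1
    refine lintegral_congr fun x => ?_
    rw [enorm_normingFun hP1, ← ENNReal.rpow_mul, hPQ.sub_one_mul_conj]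
  have hGmem : MemLp (normingFun p.toReal h) q μ :=
    ⟨hG, by rw [hGq]; exact ENNReal.rpow_lt_top_of_nonneg (by positivity) hI⟩
  have hint : ‖∫ x, conj (normingFun p.toReal h x) * h x ∂μ‖ₑ =
      ∫⁻ x, ‖h x‖ₑ ^ p.toReal ∂μ := by
    simp only [conj_normingFun_mul hPQ.pos]
    rw [integral_complex_ofReal, ← ofReal_norm, Complex.norm_real,
      Real.norm_of_nonneg (integral_nonneg fun x => by positivity),
      ofReal_integral_eq_lintegral_ofReal (hh.integrable_norm_rpow hp0 hp)
        (Filter.Eventually.of_forall fun x => by positivity)]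
    refine lintegral_congr fun x => ?_
    rw [← ofReal_norm, ENNReal.ofReal_rpow_of_nonneg (norm_nonneg _) hPQ.nonneg]
  have key : ∀ ε : ℝ≥0∞, ε ≠ 0 → ∫⁻ x, ‖h x‖ₑ ^ p.toReal ∂μ ≤
      K * (eLpNorm (normingFun p.toReal h) q μ + ε) + ε * eLpNorm h p μ := fun ε hε =>
    hint ▸ enorm_integral_conj_mul_le_of_forall_simpleFunc hq hh hGmem hK hε
  have hlim : ∫⁻ x, ‖h x‖ₑ ^ p.toReal ∂μ ≤ K * eLpNorm (normingFun p.toReal h) q μ := by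
    have ht : Filter.Tendsto (fun ε : ℝ≥0∞ =>
        K * (eLpNorm (normingFun p.toReal h) q μ + ε) + ε * eLpNorm h p μ)
        (nhdsWithin 0 (Set.Ioi 0))
        (nhds (K * (eLpNorm (normingFun p.toReal h) q μ + 0) + 0 * eLpNorm h p μ)) := by
      refine Filter.Tendsto.mono_left ?_ nhdsWithin_le_nhds
      exact (ENNReal.Tendsto.const_mul (tendsto_const_nhds.add Filter.tendsto_id)
        (Or.inr hKtop)).add (ENNReal.Tendsto.mul_const Filter.tendsto_id (Or.inr hh.2.ne))
    rw [add_zero, zero_mul, add_zero] at ht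
    refine ge_of_tendsto ht ?_
    filter_upwards [self_mem_nhdsWithin] with ε hε
    exact key ε (ne_of_gt hε)
  rw [hGq] at hlim
  rw [eLpNorm_eq_lintegral_rpow_enorm_toReal hp0 hp]
  generalize ∫⁻ x, ‖h x‖ₑ ^ p.toReal ∂μ = I at hI hlim
  rcases eq_or_ne I 0 with rfl | hI0
  · rw [ENNReal.zero_rpow_of_pos (one_div_pos.mpr hPQ.pos)]; exact zero_le
  have h2 : I = I ^ (1 / p.toReal) * I ^ (1 / q.toReal) := by
    rw [← ENNReal.rpow_add _ _ hI0 hI, one_div, one_div, hPQ.inv_add_inv_eq_one, ENNReal.rpow_one]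
  have h3 : I ^ (1 / q.toReal) ≠ 0 := by simp [hI0, hI]
  have h4 : I ^ (1 / q.toReal) ≠ ∞ := ENNReal.rpow_ne_top_of_nonneg (by positivity) hI
  refine (ENNReal.mul_le_mul_iff_left h3 h4).mp ?_
  rw [← h2]
  exact hlim

end Duality

/-! ### Superorthogonal decompositions of the identity -/

/-- A decomposition of the identity of `L^2` into finitely many self-adjoint operators that map
simple functions into all `L^q`, are type IV superorthogonal of every order on simple functions, and
satisfy the `ℓ^{2r}` valued estimates with the constants `A r`. -/
structure IsSuperorthogonalDecomposition (A : ℕ → ℝ≥0) {X : Type*} [MeasurableSpace X]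
    (μ : Measure X) {L : ℕ} (Δ : Fin L → (Lp ℂ 2 μ →L[ℂ] Lp ℂ 2 μ)) : Prop where
  isSelfAdjoint : ∀ l, IsSelfAdjoint (Δ l)
  sum_eq : ∑ l, Δ l = ContinuousLinearMap.id ℂ (Lp ℂ 2 μ)
  memLp : ∀ (f : SimpleFunc X ℂ) (hf : MemLp f 2 μ) (l : Fin L) (q : ℝ≥0∞), 1 < q → q < ∞ →
    MemLp (Δ l (hf.toLp f)) q μ
  superorthogonal : ∀ r : ℕ, 1 ≤ r → ∀ (f : SimpleFunc X ℂ) (hf : MemLp f 2 μ),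
    TypeIVSuperorthogonal μ r (fun l => Δ l (hf.toLp f)) ∧
    eLpNorm (ellNorm (2 * r) (fun l => Δ l (hf.toLp f))) ((2 * r : ℕ) : ℝ≥0∞) μ
      ≤ A r * eLpNorm f ((2 * r : ℕ) : ℝ≥0∞) μ

theorem TypeIVSuperorthogonal.const_mul {X : Type*} [MeasurableSpace X] {μ : Measure X} {r L : ℕ}
    {f : Fin L → X → ℂ} (h : TypeIVSuperorthogonal μ r f) (c : Fin L → ℂ) :
    TypeIVSuperorthogonal μ r (fun l x => c l * f l x) := by
  intro l hl
  have h1 : ∀ x, ∏ j : Fin r, (c (l ⟨2 * (j : ℕ), by omega⟩) * f (l ⟨2 * (j : ℕ), by omega⟩) x *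
        conj (c (l ⟨2 * (j : ℕ) + 1, by omega⟩) * f (l ⟨2 * (j : ℕ) + 1, by omega⟩) x)) =
      (∏ j : Fin r, (c (l ⟨2 * (j : ℕ), by omega⟩) * conj (c (l ⟨2 * (j : ℕ) + 1, by omega⟩)))) *
      ∏ j : Fin r, (f (l ⟨2 * (j : ℕ), by omega⟩) x *
        conj (f (l ⟨2 * (j : ℕ) + 1, by omega⟩) x)) := by
    intro x
    rw [← Finset.prod_mul_distrib]
    refine Finset.prod_congr rfl fun j _ => ?_
    rw [map_mul]
    ring
  simp only [h1]
  rw [integral_const_mul, h l hl, mul_zero]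

theorem norm_signOn {ι : Type*} [DecidableEq ι] (t : Finset ι) (l : ι) :
    ‖(signOn t l : ℂ)‖ = 1 := by
  unfold signOn
  split_ifs <;> simp

/-- The sum of the operators `Δ l` with the signs given by `t`. -/
noncomputable def signOp {X : Type*} [MeasurableSpace X] {μ : Measure X} {L : ℕ}
    (Δ : Fin L → (Lp ℂ 2 μ →L[ℂ] Lp ℂ 2 μ)) (t : Finset (Fin L)) : Lp ℂ 2 μ →L[ℂ] Lp ℂ 2 μ :=
  ∑ l, (signOn t l : ℂ) • Δ l

theorem coeFn_signOp {X : Type*} [MeasurableSpace X] {μ : Measure X} {L : ℕ}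
    (Δ : Fin L → (Lp ℂ 2 μ →L[ℂ] Lp ℂ 2 μ)) (t : Finset (Fin L)) (g : Lp ℂ 2 μ) :
    signOp Δ t g =ᵐ[μ] fun x => ∑ l, (signOn t l : ℂ) * Δ l g x := by
  have h1 : signOp Δ t g = ∑ l, (signOn t l : ℂ) • Δ l g := by
    rw [signOp, sum_apply]; rfl
  rw [h1]
  have h2 : ∀ᵐ x ∂μ, ∀ l, ((signOn t l : ℂ) • Δ l g : Lp ℂ 2 μ) x = (signOn t l : ℂ) * Δ l g x := by
    rw [ae_all_iff]
    intro l
    filter_upwards [Lp.coeFn_smul (signOn t l : ℂ) (Δ l g)] with x hx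
    rw [hx, Pi.smul_apply, smul_eq_mul]
  filter_upwards [Lp.coeFn_fun_finsetSum Finset.univ fun l => (signOn t l : ℂ) • Δ l g, h2]
    with x h3 h4
  rw [h3]
  exact Finset.sum_congr rfl fun l _ => h4 l

theorem inner_toLp_left {X : Type*} [MeasurableSpace X] {μ : Measure X} {f : X → ℂ}
    (hf : MemLp f 2 μ) (g : Lp ℂ 2 μ) :
    inner ℂ (hf.toLp f) g = ∫ x, conj (f x) * g x ∂μ := by
  rw [L2.inner_def]
  refine integral_congr_ae ?_
  filter_upwards [hf.coeFn_toLp] with x hx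
  rw [hx, RCLike.inner_apply, mul_comm]

theorem inner_toLp_right {X : Type*} [MeasurableSpace X] {μ : Measure X} {f : X → ℂ}
    (hf : MemLp f 2 μ) (g : Lp ℂ 2 μ) :
    inner ℂ g (hf.toLp f) = ∫ x, conj (g x) * f x ∂μ := by
  rw [L2.inner_def]
  refine integral_congr_ae ?_
  filter_upwards [hf.coeFn_toLp] with x hx
  rw [hx, RCLike.inner_apply, mul_comm]

namespace IsSuperorthogonalDecomposition

theorem sum_ae_eq {A : ℕ → ℝ≥0} {X : Type*} [MeasurableSpace X] {μ : Measure X} {L : ℕ}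
    {Δ : Fin L → (Lp ℂ 2 μ →L[ℂ] Lp ℂ 2 μ)} (H : IsSuperorthogonalDecomposition A μ Δ)
    {f : X → ℂ} (hf : MemLp f 2 μ) : (fun x => ∑ l, Δ l (hf.toLp f) x) =ᵐ[μ] f := by
  have h1 : ∑ l, Δ l (hf.toLp f) = hf.toLp f := by
    rw [← sum_apply, H.sum_eq]; rfl
  have h2 := Lp.coeFn_fun_finsetSum Finset.univ fun l => Δ l (hf.toLp f)
  rw [h1] at h2
  exact h2.symm.trans hf.coeFn_toLp

theorem isSelfAdjoint_signOp {A : ℕ → ℝ≥0} {X : Type*} [MeasurableSpace X] {μ : Measure X} {L : ℕ}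
    {Δ : Fin L → (Lp ℂ 2 μ →L[ℂ] Lp ℂ 2 μ)} (H : IsSuperorthogonalDecomposition A μ Δ)
    (t : Finset (Fin L)) : IsSelfAdjoint (signOp Δ t) := by
  refine isSelfAdjoint_sum _ fun l _ => IsSelfAdjoint.smul ?_ (H.isSelfAdjoint l)
  exact Complex.conj_ofReal _

theorem memLp_signOp {A : ℕ → ℝ≥0} {X : Type*} [MeasurableSpace X] {μ : Measure X} {L : ℕ}
    {Δ : Fin L → (Lp ℂ 2 μ →L[ℂ] Lp ℂ 2 μ)} (H : IsSuperorthogonalDecomposition A μ Δ)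
    (t : Finset (Fin L)) {f : SimpleFunc X ℂ} (hf : MemLp f 2 μ) {p : ℝ≥0∞} (h1 : 1 < p)
    (hp : p < ∞) : MemLp (signOp Δ t (hf.toLp f)) p μ :=
  MemLp.ae_eq (coeFn_signOp Δ t _).symm
    (memLp_finsetSum _ fun l _ => (H.memLp f hf l p h1 hp).const_mul _)

/-- Superorthogonality is stable under signs, so the two square function estimates of order `r`
bound all sums with signs on `L^{2r}`. -/
theorem exists_eLpNorm_signOp_le_even (A : ℕ → ℝ≥0) (r : ℕ) (hr : r ≠ 0) : ∃ C : ℝ≥0,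
    ∀ {X : Type*} [MeasurableSpace X] {μ : Measure X} {L : ℕ}
      {Δ : Fin L → (Lp ℂ 2 μ →L[ℂ] Lp ℂ 2 μ)}, IsSuperorthogonalDecomposition A μ Δ →
      ∀ (t : Finset (Fin L)) (f : SimpleFunc X ℂ) (hf : MemLp f 2 μ),
        eLpNorm (signOp Δ t (hf.toLp f)) ((2 * r : ℕ) : ℝ≥0∞) μ
          ≤ C * eLpNorm f ((2 * r : ℕ) : ℝ≥0∞) μ := by
  obtain ⟨C₁, h₁⟩ := exists_eLpNorm_sum_le_ellNorm r hr
  obtain ⟨C₂, h₂⟩ := exists_eLpNorm_ellNorm_le r hr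
  refine ⟨C₁ * (C₂ * (1 + A r)), fun {X} _ μ L Δ H t f hf => ?_⟩
  obtain ⟨hsup, hsq⟩ := H.superorthogonal r (by omega) f hf
  have hmem : ∀ l, MemLp (Δ l (hf.toLp f)) ((2 * r : ℕ) : ℝ≥0∞) μ := fun l =>
    H.memLp f hf l _ (by exact_mod_cast (by omega : 1 < 2 * r)) (ENNReal.natCast_lt_top _)
  have e1 := h₁ μ _ (hsup.const_mul fun l => (signOn t l : ℂ)) fun l => (hmem l).const_mul _
  have e2 := h₂ μ _ hsup hmem
  have e3 : ellNorm 2 (fun l x => (signOn t l : ℂ) * Δ l (hf.toLp f) x) =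
      ellNorm 2 (fun l => Δ l (hf.toLp f)) := by
    ext x
    simp only [ellNorm, norm_mul, norm_signOn, one_mul]
  rw [eLpNorm_congr_ae (coeFn_signOp Δ t _)]
  rw [e3] at e1
  rw [eLpNorm_congr_ae (H.sum_ae_eq hf)] at e2
  calc _ ≤ _ := e1
    _ ≤ C₁ * (C₂ * (eLpNorm f ((2 * r : ℕ) : ℝ≥0∞) μ +
          A r * eLpNorm f ((2 * r : ℕ) : ℝ≥0∞) μ)) := by
      gcongr
      exact e2.trans (by gcongr)
    _ = _ := by push_cast; ring

/-- Marcinkiewicz interpolation between `L^2` and an even exponent beyond `p`. -/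
theorem exists_eLpNorm_signOp_le_of_two_le (A : ℕ → ℝ≥0) {p : ℝ≥0∞} (h2 : 2 ≤ p) (hp : p < ∞) :
    ∃ C : ℝ≥0, ∀ {X : Type*} [MeasurableSpace X] {μ : Measure X} [SigmaFinite μ] {L : ℕ}
      {Δ : Fin L → (Lp ℂ 2 μ →L[ℂ] Lp ℂ 2 μ)}, IsSuperorthogonalDecomposition A μ Δ →
      ∀ (t : Finset (Fin L)) (f : SimpleFunc X ℂ) (hf : MemLp f 2 μ),
        eLpNorm (signOp Δ t (hf.toLp f)) p μ ≤ C * eLpNorm f p μ := by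
  obtain ⟨C₂, H₂⟩ := exists_eLpNorm_signOp_le_even A 1 one_ne_zero
  have hcast : ((2 * 1 : ℕ) : ℝ≥0∞) = 2 := by norm_num
  simp only [hcast] at H₂
  rcases h2.eq_or_lt with rfl | h2
  · exact ⟨C₂, fun H t f hf => H₂ H t f hf⟩
  obtain ⟨r, hr⟩ := exists_nat_gt p.toReal
  have hp2 : 2 < p.toReal := by
    rw [← ENNReal.toReal_ofNat 2]
    exact (ENNReal.toReal_lt_toReal ENNReal.ofNat_ne_top hp.ne).mpr h2
  have hr0 : r ≠ 0 := by
    rintro rfl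
    norm_num at hr
    linarith
  have hp0 : p ≠ 0 := (two_pos.trans h2).ne'
  obtain ⟨C, H⟩ := exists_eLpNorm_signOp_le_even A r hr0
  have hcast' : (((2 * r : ℕ) : ℝ≥0∞)).toReal = ((2 * r : ℕ) : ℝ) := ENNReal.toReal_natCast _
  have hrp : p.toReal < ((2 * r : ℕ) : ℝ) := by
    push_cast
    have : (0 : ℝ) ≤ r := by positivity
    linarith
  have hq0 : ((2 * r : ℕ) : ℝ≥0∞) ≠ 0 := by exact_mod_cast (by omega : 2 * r ≠ 0)
  obtain ⟨K, hK⟩ : ∃ K : ℝ≥0, (K : ℝ≥0∞) = (ENNReal.ofReal p.toReal *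
      (((C₂ ^ (2 : ℝ) : ℝ≥0) : ℝ≥0∞) * ENNReal.ofReal (2 ^ (2 : ℝ) / (p.toReal - 2)) +
        ((C ^ ((2 * r : ℕ) : ℝ) : ℝ≥0) : ℝ≥0∞) *
          ENNReal.ofReal (2 ^ ((2 * r : ℕ) : ℝ) / (((2 * r : ℕ) : ℝ) - p.toReal)))) ^
        (1 / p.toReal) := by
    refine ⟨_, ENNReal.coe_toNNReal ?_⟩
    refine ENNReal.rpow_ne_top_of_nonneg (by positivity) ?_
    exact ENNReal.mul_ne_top ENNReal.ofReal_ne_top (ENNReal.add_ne_top.mpr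
      ⟨ENNReal.mul_ne_top ENNReal.coe_ne_top ENNReal.ofReal_ne_top,
        ENNReal.mul_ne_top ENNReal.coe_ne_top ENNReal.ofReal_ne_top⟩)
  refine ⟨K, fun {X} _ μ _ L Δ hΔ t f hf => ?_⟩
  rw [eLpNorm_le_mul_iff hp0 hp.ne, hK, ← ENNReal.rpow_mul, one_div_mul_cancel (by linarith),
    ENNReal.rpow_one]
  refine marcinkiewicz_simpleFunc (signOp Δ t) hp2 hrp (fun g hg => ?_) (fun g hg => ?_) f hf
  · have := (eLpNorm_le_mul_iff two_ne_zero ENNReal.ofNat_ne_top).mp (H₂ hΔ t g hg)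
    rw [ENNReal.coe_rpow_of_nonneg _ zero_le_two]
    simpa using this
  · have := (eLpNorm_le_mul_iff hq0 (ENNReal.natCast_ne_top _)).mp (H hΔ t g hg)
    rw [hcast'] at this
    rwa [ENNReal.coe_rpow_of_nonneg _ (by positivity)]

/-- The sums with signs are bounded on `L^p`, uniformly in the signs; for `p < 2` this follows by
duality, as they are self-adjoint. -/
theorem exists_eLpNorm_signOp_le (A : ℕ → ℝ≥0) {p : ℝ≥0∞} (h1 : 1 < p) (hp : p < ∞) :
    ∃ C : ℝ≥0, ∀ {X : Type*} [MeasurableSpace X] {μ : Measure X} [SigmaFinite μ] {L : ℕ}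
      {Δ : Fin L → (Lp ℂ 2 μ →L[ℂ] Lp ℂ 2 μ)}, IsSuperorthogonalDecomposition A μ Δ →
      ∀ (t : Finset (Fin L)) (f : SimpleFunc X ℂ) (hf : MemLp f 2 μ),
        eLpNorm (signOp Δ t (hf.toLp f)) p μ ≤ C * eLpNorm f p μ := by
  rcases le_total 2 p with h2 | h2
  · exact exists_eLpNorm_signOp_le_of_two_le A h2 hp
  have hpq := ENNReal.HolderConjugate.conjExponent h1.le
  obtain ⟨q, hq⟩ : ∃ q, q = p.conjExponent := ⟨_, rfl⟩
  rw [← hq] at hpq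
  have hqtop : q < ∞ := (ENNReal.HolderConjugate.lt_top_iff_one_lt q p).mpr h1
  have hq2 : 2 ≤ q := by
    have e1 := ENNReal.HolderConjugate.inv_add_inv_eq_one p q
    rw [← ENNReal.inv_le_inv]
    have e2 : (2 : ℝ≥0∞)⁻¹ ≤ p⁻¹ := ENNReal.inv_le_inv.mpr h2
    by_contra! hcon
    have : (2 : ℝ≥0∞)⁻¹ + 2⁻¹ < p⁻¹ + q⁻¹ :=
      ENNReal.add_lt_add_of_le_of_lt (by simp) e2 hcon
    rw [e1, ENNReal.inv_two_add_inv_two] at this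
    exact lt_irrefl _ this
  obtain ⟨C, H⟩ := exists_eLpNorm_signOp_le_of_two_le A hq2 hqtop
  refine ⟨C, fun {X} _ μ _ L Δ hΔ t f hf => ?_⟩
  refine eLpNorm_le_of_forall_simpleFunc (q := q) hp.ne hqtop.ne (hΔ.memLp_signOp t hf h1 hp)
    fun g hg => ?_
  have hsymm := (hΔ.isSelfAdjoint_signOp t).isSymmetric (hg.toLp g) (hf.toLp f)
  rw [ContinuousLinearMap.coe_coe, inner_toLp_left hg, inner_toLp_right hf] at hsymm
  rw [← hsymm]
  refine (enorm_integral_conj_mul_le (p := q) (q := p) (Lp.aestronglyMeasurable _) hf.1).trans ?_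
  calc _ ≤ (C * eLpNorm g q μ) * eLpNorm f p μ := by gcongr; exact H hΔ t g hg
    _ = _ := by ring

/-- The upper square function estimate on simple functions. -/
theorem exists_eLpNorm_square_le (A : ℕ → ℝ≥0) {p : ℝ≥0∞} (h1 : 1 < p) (hp : p < ∞) :
    ∃ C : ℝ≥0, ∀ {X : Type*} [MeasurableSpace X] {μ : Measure X} [SigmaFinite μ] {L : ℕ}
      {Δ : Fin L → (Lp ℂ 2 μ →L[ℂ] Lp ℂ 2 μ)}, IsSuperorthogonalDecomposition A μ Δ →
      ∀ (f : SimpleFunc X ℂ) (hf : MemLp f 2 μ),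
        eLpNorm (ellNorm 2 fun l => Δ l (hf.toLp f)) p μ ≤ C * eLpNorm f p μ := by
  obtain ⟨C, H⟩ := exists_eLpNorm_signOp_le A h1 hp
  refine ⟨6 * C, fun {X} _ μ _ L Δ hΔ f hf => ?_⟩
  have := eLpNorm_ellNorm_two_le_of_signOn h1.le
    (f := fun l => Δ l (hf.toLp f)) (fun l => Lp.aestronglyMeasurable _)
    (K := C * eLpNorm f p μ) (fun t => by
      rw [← eLpNorm_congr_ae (coeFn_signOp Δ t _)]; exact H hΔ t f hf)
  refine this.trans_eq ?_
  push_cast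
  ring

section Orthogonality

variable {A : ℕ → ℝ≥0} {X : Type*} [MeasurableSpace X] {μ : Measure X} {L : ℕ}
  {Δ : Fin L → (Lp ℂ 2 μ →L[ℂ] Lp ℂ 2 μ)}

/-- Superorthogonality of order one, extended from simple functions to `L^2`. -/
theorem inner_self_eq_zero (H : IsSuperorthogonalDecomposition A μ Δ) {l m : Fin L} (hlm : l ≠ m)
    (f : Lp ℂ 2 μ) : inner ℂ (Δ m f) (Δ l f) = 0 := by
  have hd := Lp.simpleFunc.denseRange (E := ℂ) (μ := μ) (p := 2) ENNReal.ofNat_ne_top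
  refine hd.induction_on (p := fun f => inner ℂ (Δ m f) (Δ l f) = 0) f
    (isClosed_eq (by fun_prop) continuous_const) fun g => ?_
  have hg := Lp.simpleFunc.memLp g
  have hg' : (g : Lp ℂ 2 μ) = hg.toLp _ :=
    (congrArg Subtype.val (Lp.simpleFunc.toLp_toSimpleFunc g)).symm
  have h := (H.superorthogonal 1 le_rfl (Lp.simpleFunc.toSimpleFunc g) hg).1 ![l, m]
    (by
      intro i j hij
      fin_cases i <;> fin_cases j <;> simp_all [eq_comm])
  rw [hg', L2.inner_def]
  simpa [RCLike.inner_apply] using h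

/-- Orthogonality on the diagonal implies orthogonality of the ranges, since the scalars are
complex. -/
theorem inner_eq_zero (H : IsSuperorthogonalDecomposition A μ Δ) {l m : Fin L} (hlm : l ≠ m)
    (f g : Lp ℂ 2 μ) : inner ℂ (Δ m f) (Δ l g) = 0 := by
  have hsymm := (H.isSelfAdjoint l).isSymmetric
  have h0 : ((Δ l ∘L Δ m : Lp ℂ 2 μ →L[ℂ] Lp ℂ 2 μ) : Lp ℂ 2 μ →ₗ[ℂ] Lp ℂ 2 μ) = 0 := by
    rw [← inner_map_self_eq_zero]
    intro x
    have := hsymm (Δ m x) x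
    simp only [ContinuousLinearMap.coe_coe] at this
    simp only [ContinuousLinearMap.coe_coe, ContinuousLinearMap.comp_apply]
    rw [this]
    exact H.inner_self_eq_zero hlm x
  have h1 : Δ l (Δ m f) = 0 := LinearMap.congr_fun h0 f
  have h2 := hsymm (Δ m f) g
  simp only [ContinuousLinearMap.coe_coe] at h2
  rw [← h2, h1, inner_zero_left]

theorem inner_eq_sum (H : IsSuperorthogonalDecomposition A μ Δ) (f g : Lp ℂ 2 μ) :
    inner ℂ f g = ∑ l, inner ℂ (Δ l f) (Δ l g) := by
  have h1 : ∀ f : Lp ℂ 2 μ, f = ∑ l, Δ l f := fun f => by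
    rw [← sum_apply, H.sum_eq]; rfl
  conv_lhs => rw [h1 f, h1 g, sum_inner]
  refine Finset.sum_congr rfl fun l _ => ?_
  rw [inner_sum]
  exact Finset.sum_eq_single l (fun m _ hm => H.inner_eq_zero hm _ _) (by simp)

/-- The pairing of two functions is controlled by their square functions. -/
theorem enorm_inner_le (H : IsSuperorthogonalDecomposition A μ Δ) {p q : ℝ≥0∞}
    [p.HolderConjugate q] (f g : Lp ℂ 2 μ) :
    ‖(inner ℂ f g : ℂ)‖ₑ ≤
      eLpNorm (ellNorm 2 fun l => Δ l f) p μ * eLpNorm (ellNorm 2 fun l => Δ l g) q μ := by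
  have hm : ∀ f : Lp ℂ 2 μ, AEStronglyMeasurable (ellNorm 2 fun l => Δ l f) μ := fun f =>
    (memLp_ellNorm two_ne_zero fun l => Lp.memLp (Δ l f)).1
  refine le_trans ?_ (lintegral_enorm_mul_le (hm f) (hm g))
  rw [H.inner_eq_sum]
  simp only [L2.inner_def]
  rw [← integral_finsetSum _ fun l _ => L2.integrable_inner (Δ l f) (Δ l g)]
  refine (enorm_integral_le_lintegral_enorm _).trans (lintegral_mono fun x => ?_)
  rw [← enorm_mul, enorm_le_iff_norm_le, Real.norm_of_nonneg
    (mul_nonneg (ellNorm_nonneg _ _ _) (ellNorm_nonneg _ _ _)), ellNorm_two, ellNorm_two]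
  refine (norm_sum_le _ _).trans ?_
  refine (Finset.sum_le_sum fun l _ => norm_inner_le_norm _ _).trans ?_
  exact Real.sum_mul_le_sqrt_mul_sqrt _ _ _

end Orthogonality

/-- The lower square function estimate on simple functions, dual to the upper one. -/
theorem exists_eLpNorm_le_square (A : ℕ → ℝ≥0) {p : ℝ≥0∞} (h1 : 1 < p) (hp : p < ∞) :
    ∃ C : ℝ≥0, ∀ {X : Type*} [MeasurableSpace X] {μ : Measure X} [SigmaFinite μ] {L : ℕ}
      {Δ : Fin L → (Lp ℂ 2 μ →L[ℂ] Lp ℂ 2 μ)}, IsSuperorthogonalDecomposition A μ Δ →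
      ∀ (f : SimpleFunc X ℂ) (hf : MemLp f 2 μ),
        eLpNorm f p μ ≤ C * eLpNorm (ellNorm 2 fun l => Δ l (hf.toLp f)) p μ := by
  have hpq := ENNReal.HolderConjugate.conjExponent h1.le
  obtain ⟨q, hq⟩ : ∃ q, q = p.conjExponent := ⟨_, rfl⟩
  rw [← hq] at hpq
  have hqtop : q < ∞ := (ENNReal.HolderConjugate.lt_top_iff_one_lt q p).mpr h1
  have hq1 : 1 < q := (ENNReal.HolderConjugate.lt_top_iff_one_lt p q).mp hp
  obtain ⟨C, H⟩ := exists_eLpNorm_square_le A hq1 hqtop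
  refine ⟨C, fun {X} _ μ _ L Δ hΔ f hf => ?_⟩
  refine eLpNorm_le_of_forall_simpleFunc (q := q) hp.ne hqtop.ne (memLp_simpleFunc hf p)
    fun g hg => ?_
  have h2 : ∫ x, conj (g x) * f x ∂μ = inner ℂ (hg.toLp g) (hf.toLp f) := by
    rw [inner_toLp_left]
    refine integral_congr_ae ?_
    filter_upwards [hf.coeFn_toLp] with x hx
    rw [hx]
  rw [h2]
  refine (hΔ.enorm_inner_le (p := q) (q := p) _ _).trans ?_
  calc _ ≤ (C * eLpNorm g q μ) * eLpNorm (ellNorm 2 fun l => Δ l (hf.toLp f)) p μ := by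
        gcongr; exact H hΔ g hg
    _ = _ := by ring

end IsSuperorthogonalDecomposition

/-! ### Extension from simple functions to `L^p` -/

section Extension

variable {X : Type*} [MeasurableSpace X] {μ : Measure X} {p : ℝ≥0∞}

open Filter Topology in
/-- An `L^p` bound for simple functions extends to `L^2 ∩ L^p`, by simultaneous approximation in
`L^2` and `L^p` and Fatou's lemma. -/
theorem eLpNorm_le_of_simpleFunc [Fact (1 ≤ p)] (hp : p ≠ ∞) (D : Lp ℂ 2 μ →L[ℂ] Lp ℂ 2 μ)
    {K : ℝ≥0}
    (hD : ∀ (f : SimpleFunc X ℂ) (hf : MemLp f 2 μ),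
      eLpNorm (D (hf.toLp f)) p μ ≤ K * eLpNorm f p μ)
    {f : X → ℂ} (h2 : MemLp f 2 μ) (hfp : MemLp f p μ) :
    eLpNorm (D (h2.toLp f)) p μ ≤ K * eLpNorm f p μ := by
  wlog hf : StronglyMeasurable f generalizing f
  · have hae := h2.1.ae_eq_mk
    have := this (h2.ae_eq hae) (hfp.ae_eq hae) h2.1.stronglyMeasurable_mk
    rwa [← eLpNorm_congr_ae hae, MemLp.toLp_congr _ h2 hae.symm] at this
  have hm : Measurable f := hf.measurable
  obtain ⟨s, m2, t2, tp⟩ : ∃ (s : ℕ → SimpleFunc X ℂ) (m2 : ∀ n, MemLp (s n) 2 μ),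
      Tendsto (fun n => (m2 n).toLp (s n)) atTop (𝓝 (h2.toLp f)) ∧
        Tendsto (fun n => eLpNorm (⇑(s n) - f) p μ) atTop (𝓝 0) :=
    ⟨_, SimpleFunc.memLp_approxOn_range hm h2,
      SimpleFunc.tendsto_approxOn_range_Lp ENNReal.ofNat_ne_top hm h2,
      SimpleFunc.tendsto_approxOn_range_Lp_eLpNorm hp hm hfp.2⟩
  have tD := (D.continuous.tendsto _).comp t2
  obtain ⟨ns, hns, hae⟩ := (tendstoInMeasure_of_tendsto_Lp tD).exists_seq_tendsto_ae
  refine (Lp.eLpNorm_lim_le_liminf_eLpNorm (fun n => Lp.aestronglyMeasurable _) _ hae).trans ?_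
  have hb : Tendsto (fun n => (K : ℝ≥0∞) * (eLpNorm (⇑(s (ns n)) - f) p μ + eLpNorm f p μ)) atTop
      (𝓝 (K * (0 + eLpNorm f p μ))) :=
    ENNReal.Tendsto.const_mul ((tp.comp hns.tendsto_atTop).add tendsto_const_nhds)
      (Or.inr ENNReal.coe_ne_top)
  rw [zero_add] at hb
  rw [← hb.liminf_eq]
  refine liminf_le_liminf (Eventually.of_forall fun n => ?_)
  refine (hD (s (ns n)) (m2 _)).trans ?_
  gcongr
  calc eLpNorm (s (ns n)) p μ = eLpNorm ((⇑(s (ns n)) - f) + f) p μ := by rw [sub_add_cancel]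
    _ ≤ _ := eLpNorm_add_le ((m2 _).1.sub h2.1) h2.1 Fact.out

/-- An operator that is bounded in the `L^p` norm on simple functions has a bounded extension to
`L^p`: it is extended from the dense subspace `L^2 ∩ L^p`. -/
theorem exists_isLpExtension [Fact (1 ≤ p)] (hp : p ≠ ∞) (D : Lp ℂ 2 μ →L[ℂ] Lp ℂ 2 μ) {K : ℝ≥0}
    (hD : ∀ (f : SimpleFunc X ℂ) (hf : MemLp f 2 μ),
      eLpNorm (D (hf.toLp f)) p μ ≤ K * eLpNorm f p μ) :
    ∃ T : Lp ℂ p μ →L[ℂ] Lp ℂ p μ, IsLpExtension D T := by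
  let S : Submodule ℂ (Lp ℂ p μ) :=
    { carrier := {f | MemLp f 2 μ}
      add_mem' := fun {f g} hf hg => (hf.add hg).ae_eq (Lp.coeFn_add f g).symm
      zero_mem' := MemLp.zero.ae_eq (Lp.coeFn_zero ℂ p μ).symm
      smul_mem' := fun c f hf => (hf.const_smul c).ae_eq (Lp.coeFn_smul c f).symm }
  have hS : ∀ f : S, MemLp (f : Lp ℂ p μ) 2 μ := fun f => f.2
  have hb : ∀ f : S, eLpNorm (D ((hS f).toLp _)) p μ ≤ K * eLpNorm (f : Lp ℂ p μ) p μ := fun f =>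
    eLpNorm_le_of_simpleFunc hp D hD (hS f) (Lp.memLp _)
  have hmem : ∀ f : S, MemLp (D ((hS f).toLp _)) p μ := fun f =>
    ⟨Lp.aestronglyMeasurable _,
      (hb f).trans_lt (ENNReal.mul_lt_top ENNReal.coe_lt_top (Lp.eLpNorm_lt_top _))⟩
  let T₀ : S →ₗ[ℂ] Lp ℂ p μ :=
    { toFun := fun f => (hmem f).toLp _
      map_add' := fun f g => by
        rw [← MemLp.toLp_add]
        refine MemLp.toLp_congr _ _ ?_
        have e : (hS (f + g)).toLp _ = (hS f).toLp _ + (hS g).toLp _ := by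
          rw [← MemLp.toLp_add]
          exact MemLp.toLp_congr _ _ (Lp.coeFn_add _ _)
        rw [e, map_add]
        exact Lp.coeFn_add _ _
      map_smul' := fun c f => by
        rw [RingHom.id_apply, ← MemLp.toLp_const_smul]
        refine MemLp.toLp_congr _ _ ?_
        have e : (hS (c • f)).toLp _ = c • (hS f).toLp _ := by
          rw [← MemLp.toLp_const_smul]
          exact MemLp.toLp_congr _ _ (Lp.coeFn_smul _ _)
        rw [e, map_smul]
        exact Lp.coeFn_smul _ _ }
  have hdense : DenseRange S.subtype := by
    refine (Lp.simpleFunc.denseRange (E := ℂ) (μ := μ) hp).mono ?_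
    rintro _ ⟨g, rfl⟩
    refine ⟨⟨g, ?_⟩, rfl⟩
    exact (memLp_two_simpleFunc (zero_lt_one.trans_le Fact.out).ne' hp
      (Lp.simpleFunc.memLp g)).ae_eq (Lp.simpleFunc.toSimpleFunc_eq_toFun g)
  have hnorm : ∃ C : ℝ, ∀ f : S, ‖T₀ f‖ ≤ C * ‖S.subtype f‖ := by
    refine ⟨K, fun f => ?_⟩
    change ‖(hmem f).toLp _‖ ≤ K * ‖(f : Lp ℂ p μ)‖
    rw [Lp.norm_toLp, Lp.norm_def, ← ENNReal.coe_toReal, ← ENNReal.toReal_mul]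
    exact ENNReal.toReal_mono (ENNReal.mul_ne_top ENNReal.coe_ne_top (Lp.eLpNorm_ne_top _)) (hb f)
  refine ⟨T₀.extendOfNorm S.subtype, fun f h2 hfp => ?_⟩
  have hf : hfp.toLp f ∈ S := h2.ae_eq hfp.coeFn_toLp.symm
  have h1 := LinearMap.extendOfNorm_eq hdense hnorm ⟨hfp.toLp f, hf⟩
  rw [Submodule.subtype_apply] at h1
  rw [h1]
  refine (hmem ⟨hfp.toLp f, hf⟩).coeFn_toLp.trans ?_
  rw [MemLp.toLp_congr (hS ⟨hfp.toLp f, hf⟩) h2 hfp.coeFn_toLp]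

theorem IsLpExtension.apply_simpleFunc [Fact (1 ≤ p)] {D : Lp ℂ 2 μ →L[ℂ] Lp ℂ 2 μ}
    {T : Lp ℂ p μ →L[ℂ] Lp ℂ p μ} (hT : IsLpExtension D T) (g : Lp.simpleFunc ℂ p μ)
    (h2 : MemLp (Lp.simpleFunc.toSimpleFunc g) 2 μ) : T g =ᵐ[μ] D (h2.toLp _) := by
  have := hT _ h2 (Lp.simpleFunc.memLp g)
  rwa [show (Lp.simpleFunc.memLp g).toLp _ = (g : Lp ℂ p μ) from
    congrArg Subtype.val (Lp.simpleFunc.toLp_toSimpleFunc g)] at this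

theorem IsLpExtension.unique [Fact (1 ≤ p)] (hp : p ≠ ∞) {D : Lp ℂ 2 μ →L[ℂ] Lp ℂ 2 μ}
    {T T' : Lp ℂ p μ →L[ℂ] Lp ℂ p μ} (hT : IsLpExtension D T) (hT' : IsLpExtension D T') :
    T = T' := by
  refine ContinuousLinearMap.ext fun f => congrFun ((Lp.simpleFunc.denseRange hp).equalizer
    T.continuous T'.continuous (funext fun g => ?_)) f
  have h2 := memLp_two_simpleFunc (zero_lt_one.trans_le Fact.out).ne' hp (Lp.simpleFunc.memLp g)
  exact Lp.ext ((hT.apply_simpleFunc g h2).trans (hT'.apply_simpleFunc g h2).symm)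

theorem ellNorm_two_eq_norm {X : Type*} {L : ℕ} (f : Fin L → X → ℂ) (x : X) :
    ellNorm 2 f x = ‖WithLp.toLp 2 (fun l => f l x)‖ := by
  rw [ellNorm_two, EuclideanSpace.norm_eq]

theorem ellNorm_two_le_add_sum {X : Type*} {L : ℕ} (f g : Fin L → X → ℂ) (x : X) :
    ellNorm 2 f x ≤ ellNorm 2 g x + ∑ l, ‖f l x - g l x‖ := by
  have h1 := ellNorm_le_sum two_ne_zero (fun l x => f l x - g l x) x
  have h2 : WithLp.toLp 2 (fun l => f l x) =
      WithLp.toLp 2 (fun l => g l x) + WithLp.toLp 2 (fun l => f l x - g l x) := by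
    rw [← WithLp.toLp_add]
    congr 1
    ext l
    simp
  have h3 := norm_add_le (WithLp.toLp 2 (fun l => g l x))
    (WithLp.toLp 2 (fun l => f l x - g l x))
  rw [← h2, ← ellNorm_two_eq_norm, ← ellNorm_two_eq_norm,
    ← ellNorm_two_eq_norm (fun l x => f l x - g l x)] at h3
  linarith

/-- The norm of the square function of finitely many bounded operators is continuous on `L^p`. -/
theorem continuous_toReal_eLpNorm_ellNorm [Fact (1 ≤ p)] {L : ℕ}
    (T : Fin L → (Lp ℂ p μ →L[ℂ] Lp ℂ p μ)) :
    Continuous fun f : Lp ℂ p μ => (eLpNorm (ellNorm 2 fun l => T l f) p μ).toReal := by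
  have hmem : ∀ f : Lp ℂ p μ, MemLp (ellNorm 2 fun l => T l f) p μ := fun f =>
    memLp_ellNorm two_ne_zero fun l => Lp.memLp _
  refine (LipschitzWith.of_le_add_mul (∑ l, ‖T l‖₊) fun f g => ?_).continuous
  have h1 : eLpNorm (ellNorm 2 fun l => T l f) p μ ≤
      eLpNorm (ellNorm 2 fun l => T l g) p μ + ∑ l, eLpNorm (⇑(T l f) - ⇑(T l g)) p μ := by
    have hm : ∀ l, AEStronglyMeasurable (fun x => ‖T l f x - T l g x‖) μ := fun l =>
      ((Lp.aestronglyMeasurable _).sub (Lp.aestronglyMeasurable _)).norm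
    calc eLpNorm (ellNorm 2 fun l => T l f) p μ
        ≤ eLpNorm ((ellNorm 2 fun l => T l g) +
            ∑ l, fun x => ‖T l f x - T l g x‖) p μ := by
          refine eLpNorm_mono_real fun x => ?_
          rw [Real.norm_of_nonneg (ellNorm_nonneg _ _ _), Pi.add_apply, Finset.sum_apply]
          exact ellNorm_two_le_add_sum _ _ x
      _ ≤ eLpNorm (ellNorm 2 fun l => T l g) p μ +
            eLpNorm (∑ l, fun x => ‖T l f x - T l g x‖) p μ :=
          eLpNorm_add_le (hmem g).1 (Finset.aestronglyMeasurable_sum _ fun l _ => hm l) Fact.out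
      _ ≤ _ := by
        gcongr
        refine (eLpNorm_sum_le (fun l _ => hm l) Fact.out).trans_eq ?_
        exact Finset.sum_congr rfl fun l _ => eLpNorm_norm _
  have h2 : ∀ l, eLpNorm (⇑(T l f) - ⇑(T l g)) p μ ≠ ∞ := fun l =>
    ((Lp.memLp _).sub (Lp.memLp _)).2.ne
  have h3 := ENNReal.toReal_mono (ENNReal.add_ne_top.mpr
    ⟨(hmem g).2.ne, ENNReal.sum_ne_top.mpr fun l _ => h2 l⟩) h1
  rw [ENNReal.toReal_add (hmem g).2.ne (ENNReal.sum_ne_top.mpr fun l _ => h2 l),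
    ENNReal.toReal_sum fun l _ => h2 l] at h3
  refine h3.trans ?_
  gcongr
  rw [NNReal.coe_sum, Finset.sum_mul]
  refine Finset.sum_le_sum fun l _ => ?_
  rw [← Lp.dist_def, dist_eq_norm, ← map_sub, dist_eq_norm]
  exact (T l).le_opNorm _

end Extension

namespace IsSuperorthogonalDecomposition

/-- The square function estimates pass from simple functions to the extensions to `L^p`. -/
theorem square_estimate {X : Type*} [MeasurableSpace X] {μ : Measure X} {p : ℝ≥0∞} [Fact (1 ≤ p)]
    (hp : p ≠ ∞) {L : ℕ} {Δ : Fin L → (Lp ℂ 2 μ →L[ℂ] Lp ℂ 2 μ)} {C : ℝ≥0}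
    (hlow : ∀ (f : SimpleFunc X ℂ) (hf : MemLp f 2 μ),
      eLpNorm f p μ ≤ C * eLpNorm (ellNorm 2 fun l => Δ l (hf.toLp f)) p μ)
    (hup : ∀ (f : SimpleFunc X ℂ) (hf : MemLp f 2 μ),
      eLpNorm (ellNorm 2 fun l => Δ l (hf.toLp f)) p μ ≤ C * eLpNorm f p μ)
    {T : Fin L → (Lp ℂ p μ →L[ℂ] Lp ℂ p μ)} (hT : ∀ l, IsLpExtension (Δ l) (T l))
    (f : Lp ℂ p μ) :
    eLpNorm f p μ ≤ C * eLpNorm (ellNorm 2 fun l => T l f) p μ ∧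
      eLpNorm (ellNorm 2 fun l => T l f) p μ ≤ C * eLpNorm f p μ := by
  have hfin : ∀ f : Lp ℂ p μ, eLpNorm (ellNorm 2 fun l => T l f) p μ ≠ ∞ := fun f =>
    (memLp_ellNorm two_ne_zero fun l => Lp.memLp _).2.ne
  have hreal : ∀ f : Lp ℂ p μ,
      ‖f‖ ≤ C * (eLpNorm (ellNorm 2 fun l => T l f) p μ).toReal ∧
        (eLpNorm (ellNorm 2 fun l => T l f) p μ).toReal ≤ C * ‖f‖ := by
    intro f
    have hc := continuous_toReal_eLpNorm_ellNorm T
    refine (Lp.simpleFunc.denseRange hp).induction_on (p := fun f : Lp ℂ p μ =>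
      ‖f‖ ≤ C * (eLpNorm (ellNorm 2 fun l => T l f) p μ).toReal ∧
        (eLpNorm (ellNorm 2 fun l => T l f) p μ).toReal ≤ C * ‖f‖) f
      ((isClosed_le continuous_norm (hc.const_mul _)).inter
        (isClosed_le hc (continuous_norm.const_mul _))) fun g => ?_
    have h2 := memLp_two_simpleFunc (zero_lt_one.trans_le Fact.out).ne' hp
      (Lp.simpleFunc.memLp g)
    have hae : ellNorm 2 (fun l => Δ l (h2.toLp _)) =ᵐ[μ]
        ellNorm 2 fun l => T l (g : Lp ℂ p μ) := by
      filter_upwards [ae_all_iff.mpr fun l => (hT l).apply_simpleFunc g h2] with x hx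
      simp only [ellNorm, hx]
    have hg := eLpNorm_congr_ae (p := p) (Lp.simpleFunc.toSimpleFunc_eq_toFun g)
    have h3 := hlow _ h2
    have h4 := hup _ h2
    rw [eLpNorm_congr_ae hae, hg] at h3 h4
    rw [Lp.norm_def]
    refine ⟨?_, ?_⟩
    · have := ENNReal.toReal_mono (ENNReal.mul_ne_top ENNReal.coe_ne_top (hfin g)) h3
      rwa [ENNReal.toReal_mul, ENNReal.coe_toReal] at this
    · have := ENNReal.toReal_mono (ENNReal.mul_ne_top ENNReal.coe_ne_top
        (Lp.eLpNorm_ne_top (g : Lp ℂ p μ))) h4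
      rwa [ENNReal.toReal_mul, ENNReal.coe_toReal] at this
  obtain ⟨h3, h4⟩ := hreal f
  rw [Lp.norm_def] at h3 h4
  refine ⟨?_, ?_⟩
  · rw [← ENNReal.toReal_le_toReal (Lp.eLpNorm_ne_top f)
      (ENNReal.mul_ne_top ENNReal.coe_ne_top (hfin f)), ENNReal.toReal_mul, ENNReal.coe_toReal]
    exact h3
  · rw [← ENNReal.toReal_le_toReal (hfin f)
      (ENNReal.mul_ne_top ENNReal.coe_ne_top (Lp.eLpNorm_ne_top f)), ENNReal.toReal_mul,
      ENNReal.coe_toReal]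
    exact h4

end IsSuperorthogonalDecomposition

theorem corollary1p3 (A : ℕ → ℝ≥0) (p : ℝ≥0∞) [Fact (1 ≤ p)] (hp1 : 1 < p) (hp : p < ∞) :
    ∃ C : ℝ≥0, ∀ (X : Type*) [MeasurableSpace X] (μ : Measure X) [SigmaFinite μ]
      (L : ℕ) (Δ : Fin L → (Lp ℂ 2 μ →L[ℂ] Lp ℂ 2 μ)),
      (∀ l, IsSelfAdjoint (Δ l)) →
      ∑ l, Δ l = ContinuousLinearMap.id ℂ (Lp ℂ 2 μ) →
      (∀ (f : SimpleFunc X ℂ) (hf : MemLp f 2 μ) (l : Fin L) (q : ℝ≥0∞), 1 < q → q < ∞ →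
        MemLp (Δ l (hf.toLp f)) q μ) →
      (∀ r : ℕ, 1 ≤ r → ∀ (f : SimpleFunc X ℂ) (hf : MemLp f 2 μ),
        TypeIVSuperorthogonal μ r (fun l => Δ l (hf.toLp f)) ∧
        eLpNorm (ellNorm (2 * r) (fun l => Δ l (hf.toLp f))) ((2 * r : ℕ) : ℝ≥0∞) μ
          ≤ A r * eLpNorm f ((2 * r : ℕ) : ℝ≥0∞) μ) →
      (∀ l, ∃! T : Lp ℂ p μ →L[ℂ] Lp ℂ p μ, IsLpExtension (Δ l) T) ∧
      ∀ T : Fin L → (Lp ℂ p μ →L[ℂ] Lp ℂ p μ), (∀ l, IsLpExtension (Δ l) (T l)) →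
        ∀ f : Lp ℂ p μ,
          eLpNorm f p μ ≤ C * eLpNorm (ellNorm 2 (fun l => T l f)) p μ ∧
          eLpNorm (ellNorm 2 (fun l => T l f)) p μ ≤ C * eLpNorm f p μ := by
  obtain ⟨C₁, hlow⟩ := IsSuperorthogonalDecomposition.exists_eLpNorm_le_square A hp1 hp
  obtain ⟨C₂, hup⟩ := IsSuperorthogonalDecomposition.exists_eLpNorm_square_le A hp1 hp
  refine ⟨max C₁ C₂, fun X _ μ _ L Δ hsa hsum hmem hsup => ?_⟩
  have H : IsSuperorthogonalDecomposition A μ Δ := ⟨hsa, hsum, hmem, hsup⟩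
  refine ⟨fun l => ?_, fun T hT f => ?_⟩
  · obtain ⟨T, hT⟩ := exists_isLpExtension hp.ne (Δ l) (K := C₂) fun f hf => by
      refine le_trans (eLpNorm_mono_real fun x => ?_) (hup H f hf)
      rw [ellNorm_two]
      refine Real.le_sqrt_of_sq_le ?_
      exact Finset.single_le_sum (f := fun l => ‖Δ l (hf.toLp f) x‖ ^ 2)
        (fun i _ => by positivity) (Finset.mem_univ l)
    exact ⟨T, hT, fun T' hT' => hT'.unique hp.ne hT⟩
  · refine IsSuperorthogonalDecomposition.square_estimate hp.ne
      (fun f hf => (hlow H f hf).trans ?_) (fun f hf => (hup H f hf).trans ?_) hT f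
    · gcongr
      exact le_max_left _ _
    · gcongr
      exact le_max_right _ _
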